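/- For a Borel measure $\mu$ on $\mathbb R^n$ put $$\Gamma(\mu)=\sup_{Q}\ \liminf_{\varepsilon\to 0+}\frac{\mu\big((Q+\varepsilon B_2^n)\setminus Q\big)}{\varepsilon},$$ where $Q$ runs over all convex subsets of $\mathbb R^n$ and $B_2^n$ is the closed Euclidean unit ball. The measure $\mu$ is log-concave if $\mu(\lambda A+(1-\lambda)B)\ge\mu(A)^{\lambda}\mu(B)^{1-\lambda}$ for all Borel sets $A,B$ and all $\lambda\in(0,1)$, and a probability measure $\mu$ is isotropic if it has barycenter $0$ and $\int\langle x,\theta\rangle^2\,d\mu(x)=1$ for every unit vector $\theta$. A log-concave density of $\mu$ is a density of $\mu$ of the form $f=e^{-\varphi}$ with $\varphi:\mathbb R^n\to(-\infty,\infty]$ convex. For such $f$ and $t>0$, let $K_t(f)=\{x: f(x)\ge t\}$; $|\cdot|$ is Lebesgue measure and $\|f\|_\infty$ is the $L^\infty$ norm. There are absolute constants $C_1,C_2,C>0$ such that the following holds for every $n\ge 1$. Let $\mu$ be an isotropic log-concave probability measure on $\mathbb R^n$ which satisfies at least one of the conditions (a) $\mu$ is the uniform probability measure on a convex set; (b)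 $\mu$ has homogeneous level sets: for some log-concave density $f$ of $\mu$ and some set $K$, each level set $K_t(f)$ with $0<t<\|f\|_\infty$ is of the form $y+rK$ with $r>0$ and $y\in\mathbb R^n$; (c) $\mu$ is 1-symmetric: invariant under all permutations and all sign changes of the coordinates. Then $\mu$ has a log-concave density, and for every log-concave density $f$ of $\mu$ there are $t>0$ and $y\in\mathbb R^n$ with $$|K_t(f)|\le\frac{C_1}{\|f\|_\infty}\qquad\text{and}\qquad y+C_2B_2^n\subset K_t(f).$$ Moreover $\Gamma(\mu)\le Cn$. In particular, (b) covers measures with a density of the form $c\,e^{-\|x\|}$: every measure on $\mathbb R^n$, $n\ge1$, that has such a density, with $c>0$ and $\|\cdot\|$ a norm on $\mathbb R^n$, has homogeneous level sets. The bound on $\Gamma$ is sharp in order in all three classes: there is an absolute constant $c>0$ such that for every $n\ge 1$ some isotropic log-concave probability measure $\mu$ on $\mathbb R^n$ satisfies (a), (b) and (c) together and has $\Gamma(\mu)\ge cn$. -/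

import Mathlib

open MeasureTheory Filter Topology
open scoped ENNReal Pointwise

/-- Outer perimeter of `Q` with respect to `μ`: the lower limit, as `ε → 0+`, of
`μ ((Q + ε B) \ Q) / ε`, where `B` is the closed Euclidean unit ball. -/
noncomputable def perimeter {n : ℕ} (μ : Measure (EuclideanSpace ℝ (Fin n)))
    (Q : Set (EuclideanSpace ℝ (Fin n))) : ℝ≥0∞ :=
  liminf (fun ε : ℝ => μ ((Q + ε • Metric.closedBall 0 1) \ Q) / ENNReal.ofReal ε) (𝓝[>] 0)

/-- The maximal perimeter `Γ(μ)` over all convex sets. -/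
noncomputable def maxPerimeter {n : ℕ} (μ : Measure (EuclideanSpace ℝ (Fin n))) : ℝ≥0∞ :=
  ⨆ (Q : Set (EuclideanSpace ℝ (Fin n))) (_ : Convex ℝ Q), perimeter μ Q

/-- Log-concave measures. For `l = 0` and `l = 1` the inequality is trivial for nonempty sets (and
meaningless for empty ones, because of the convention `0 ^ 0 = 1`). -/
def IsLogConcaveMeasure {n : ℕ} (μ : Measure (EuclideanSpace ℝ (Fin n))) : Prop :=
  ∀ A B : Set (EuclideanSpace ℝ (Fin n)), MeasurableSet A → MeasurableSet B →
    ∀ l : ℝ, 0 < l → l < 1 → μ A ^ l * μ B ^ (1 - l) ≤ μ (l • A + (1 - l) • B)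

/-- Isotropic probability measures: barycenter at the origin and identity covariance. The
nonzero value `1` of the second moments forces all the integrands to be integrable. -/
structure IsIsotropicMeasure {n : ℕ} (μ : Measure (EuclideanSpace ℝ (Fin n))) : Prop where
  isProbabilityMeasure : IsProbabilityMeasure μ
  barycenter_eq_zero : ∫ x, x ∂μ = 0
  second_moment : ∀ θ : EuclideanSpace ℝ (Fin n), ‖θ‖ = 1 → ∫ x, (inner ℝ x θ) ^ 2 ∂μ = 1

/-- `f` is a density of `μ` of the form `exp (-φ)` with `φ` convex and valued in `(-∞, ∞]`, that
is, a nonnegative log-concave density. (Such an `f` is automatically Lebesgue measurable.) -/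
structure IsLogConcaveDensity {n : ℕ} (f : EuclideanSpace ℝ (Fin n) → ℝ)
    (μ : Measure (EuclideanSpace ℝ (Fin n))) : Prop where
  nonneg : ∀ x, 0 ≤ f x
  logConcave : ∀ x y : EuclideanSpace ℝ (Fin n), ∀ l : ℝ, 0 ≤ l → l ≤ 1 →
    f x ^ l * f y ^ (1 - l) ≤ f (l • x + (1 - l) • y)
  eq_withDensity : μ = volume.withDensity (fun x => ENNReal.ofReal (f x))

/-- The level set `K_t(f)`. -/
def levelSet {n : ℕ} (f : EuclideanSpace ℝ (Fin n) → ℝ) (t : ℝ) :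
    Set (EuclideanSpace ℝ (Fin n)) :=
  {x | t ≤ f x}

/-- `μ` is the uniform probability measure on a convex set. -/
def IsUniformOnConvex {n : ℕ} (μ : Measure (EuclideanSpace ℝ (Fin n))) : Prop :=
  ∃ K : Set (EuclideanSpace ℝ (Fin n)), Convex ℝ K ∧ volume K ≠ 0 ∧ volume K ≠ ∞ ∧
    μ = (volume K)⁻¹ • volume.restrict K

/-- `μ` has homogeneous level sets: it has a log-concave density `f` all of whose level sets
`K_t(f)`, `0 < t < ‖f‖_∞`, are positive dilates, up to translation, of one and the same set. -/
def HasHomogeneousLevelSets {n : ℕ} (μ : Measure (EuclideanSpace ℝ (Fin n))) : Prop :=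
  ∃ f : EuclideanSpace ℝ (Fin n) → ℝ, IsLogConcaveDensity f μ ∧
    ∃ K : Set (EuclideanSpace ℝ (Fin n)),
      ∀ t : ℝ, 0 < t → ENNReal.ofReal t < eLpNorm f ∞ volume →
        ∃ r : ℝ, 0 < r ∧ ∃ y : EuclideanSpace ℝ (Fin n), levelSet f t = {y} + r • K

/-- `μ` has a density of the form `c * exp (-p x)` with `p` a norm. -/
def HasExpNormDensity {n : ℕ} (μ : Measure (EuclideanSpace ℝ (Fin n))) : Prop :=
  ∃ (p : Seminorm ℝ (EuclideanSpace ℝ (Fin n))) (c : ℝ), (∀ x, p x = 0 → x = 0) ∧ 0 < c ∧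
    μ = volume.withDensity (fun x => ENNReal.ofReal (c * Real.exp (-p x)))

/-- `μ` is 1-symmetric: invariant under the symmetries of the cube, that is, under all
permutations and sign changes of the coordinates. -/
def IsOneSymmetric {n : ℕ} (μ : Measure (EuclideanSpace ℝ (Fin n))) : Prop :=
  ∀ (σ : Equiv.Perm (Fin n)) (s : Fin n → ℤˣ),
    μ.map (fun x : EuclideanSpace ℝ (Fin n) =>
      WithLp.toLp 2 (fun i => ((s i : ℤ) : ℝ) * x (σ i))) = μ

/-! ### Outer shells of convex sets. -/

section Perimeter

variable {E : Type*} [NormedAddCommGroup E] [InnerProductSpace ℝ E]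

/-! The perimeter bound follows from one good level set. Pushing points away from a convex `Q` along
its outer normals expands distances, so the `ε`-shell of `Q` inside a convex `L` has volume at most
that of the `ε`-shell of `L` (`Convex.addHaar_shell_inter_le`). If `L` contains a ball of radius
`ρ`, dilation about its centre bounds the latter by `((1 + ε/ρ)^n - 1)|L|`. In the layer-cake
formula for the shell, levels below `t` are treated with `L = K_s(f)`, levels above `t` with `L =
K_t(f)`. If `|K_t(f)| ≤ C/‖f‖_∞` and `K_t(f)` contains a `ρ`-ball, then `Γ(μ) ≤ (1 + C)n/ρ`
(`IsLogConcaveDensity.maxPerimeter_le`).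

To find such a level, `exists_levels` produces `t₁ ≤ t₀` with `K_{t₁}` carrying almost all the mass,
`|K_{t₀}| ≤ 2/‖f‖_∞`, and `|K_{t₁}| ≤ B^n |K_{t₀}|` for an absolute `B`. In an isotropic log-concave
measure every half-space at distance `1/960` from the origin has mass above `10⁻⁶`, so a convex set
missing at most that mass contains a fixed ball (`ball_subset_interior`); this applies to `K_{t₁}`.
For a uniform measure one level already has full mass. With homogeneous level sets, `K_{t₀}` is a
copy of `K_{t₁}` shrunk by a factor of at most `B`. For 1-symmetric measures, the volume of `K_{t₀}`
forces a point with large mean absolute coordinate, and symmetry then yields a cube.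

The density comes from Borell's theorem, proved through lower densities on small balls. Sharpness is
witnessed by the cube `[-√3, √3]^n`, with a slightly smaller concentric cube as the test set; its
log-concavity rests on Prékopa–Leindler. -/

theorem Convex.exists_infDist_eq_norm_sub [CompleteSpace E] {Q : Set E} (hQ : Convex ℝ Q)
    (hc : IsClosed Q) (hne : Q.Nonempty) (x : E) :
    ∃ p ∈ Q, Metric.infDist x Q = ‖x - p‖ ∧ ∀ w ∈ Q, inner ℝ (x - p) (w - p) ≤ 0 := by
  obtain ⟨p, hp, h⟩ := exists_norm_eq_iInf_of_complete_convex hne hc.isComplete hQ x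
  refine ⟨p, hp, ?_, (norm_eq_iInf_iff_real_inner_le_zero hQ hp).1 h⟩
  rw [h, Metric.infDist_eq_iInf]
  simp only [dist_eq_norm]

/-- Moving away from a closed convex set along the outer normals is an expanding map. -/
theorem Convex.exists_expanding_map [CompleteSpace E] {Q : Set E} (hQ : Convex ℝ Q)
    (hc : IsClosed Q) (hne : Q.Nonempty) {ε : ℝ} (hε : 0 ≤ ε) :
    ∃ T : E → E, (∀ x, ‖T x - x‖ ≤ ε) ∧ (∀ x y, dist x y ≤ dist (T x) (T y)) ∧
      ∀ x, 0 < Metric.infDist x Q → Metric.infDist (T x) Q = Metric.infDist x Q + ε := by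
  choose π hπQ hd hπ using hQ.exists_infDist_eq_norm_sub hc hne
  set d : E → ℝ := fun x => Metric.infDist x Q with hddef
  set N : E → E := fun x => (d x)⁻¹ • (x - π x) with hN
  have hd0 : ∀ x, 0 ≤ d x := fun x => Metric.infDist_nonneg
  have hNn : ∀ x, ‖N x‖ ≤ 1 := fun x => by
    rw [hN, norm_smul, ← hd x, Real.norm_of_nonneg (inv_nonneg.2 (hd0 x))]
    exact inv_mul_le_one
  have hNpos : ∀ x, 0 < d x → ‖N x‖ = 1 := fun x hx => by
    rw [hN, norm_smul, ← hd x, Real.norm_of_nonneg (inv_nonneg.2 (hd0 x))]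
    exact inv_mul_cancel₀ hx.ne'
  -- `N x` is a subgradient at `x` of the convex function `d`. On the closed set itself `N x = 0`
  -- and the claim is `0 ≤ d z`.
  have hsub : ∀ x z, inner ℝ (N x) (z - x) ≤ d z - d x := by
    intro x z
    rcases (hd0 x).eq_or_lt with h | h
    · simp only [hN, ← h]
      simpa using hd0 z
    · have h1 : inner ℝ (x - π x) (z - π x) ≤ d x * d z := by
        have e : z - π x = (z - π z) + (π z - π x) := by abel
        rw [e, inner_add_right]
        have := real_inner_le_norm (x - π x) (z - π z)
        rw [← hd x, ← hd z] at this
        linarith [hπ x (π z) (hπQ z)]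
      have h2 : inner ℝ (x - π x) (z - π x) = inner ℝ (x - π x) (z - x) + d x * d x := by
        have e : z - π x = (z - x) + (x - π x) := by abel
        rw [e, inner_add_right, real_inner_self_eq_norm_mul_norm, ← hd x]
      simp only [hN, real_inner_smul_left]
      rw [inv_mul_le_iff₀ h]
      linarith
  refine ⟨fun x => x + ε • N x, fun x => ?_, fun x y => ?_, fun x hx => ?_⟩
  · rw [add_sub_cancel_left, norm_smul, Real.norm_of_nonneg hε]
    exact mul_le_of_le_one_right hε (hNn x)
  · rw [dist_eq_norm, dist_eq_norm]
    have e : x + ε • N x - (y + ε • N y) = (x - y) + ε • (N x - N y) := by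
      rw [smul_sub]; abel
    -- Adding the subgradient inequalities at `x` and `y` shows that `N` is monotone, which makes `x
    -- + ε N x` expanding.
    have hm : 0 ≤ inner ℝ (x - y) (N x - N y) := by
      have a := hsub x y
      have b := hsub y x
      have : inner ℝ (x - y) (N x - N y) = -(inner ℝ (N x) (y - x)) - inner ℝ (N y) (x - y) := by
        rw [real_inner_comm, inner_sub_left, ← inner_neg_right, neg_sub]
      linarith
    rw [e]
    refine le_of_sq_le_sq ?_ (norm_nonneg _)
    rw [norm_add_sq_real, real_inner_smul_right]
    nlinarith [sq_nonneg ‖ε • (N x - N y)‖, mul_nonneg hε hm]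
  · refine le_antisymm ?_ ?_
    · have h1 : d (x + ε • N x) ≤ ‖x + ε • N x - π x‖ := by
        rw [← dist_eq_norm]
        exact Metric.infDist_le_dist_of_mem (hπQ x)
      have e : x + ε • N x - π x = (x - π x) + ε • N x := by abel
      refine h1.trans ?_
      rw [e]
      refine (norm_add_le _ _).trans ?_
      rw [← hd x, norm_smul, hNpos x hx, Real.norm_of_nonneg hε, mul_one]
    · have := hsub x (x + ε • N x)
      rw [add_sub_cancel_left, real_inner_smul_right, real_inner_self_eq_norm_mul_norm,
        hNpos x hx] at this
      have h2 : ε ≤ d (x + ε • N x) - d x := by linarith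
      change d x + ε ≤ d (x + ε • N x)
      linarith

variable [FiniteDimensional ℝ E] [MeasurableSpace E] [BorelSpace E]

/-- Haar measure is a multiple of Hausdorff measure of the top dimension, which an antilipschitz map
with constant one cannot decrease. No measurability of `T` or `A` is involved. -/
theorem MeasureTheory.Measure.addHaar_le_addHaar_image_of_expanding (μ : Measure E)
    [μ.IsAddHaarMeasure] {T : E → E} (hT : ∀ x y, dist x y ≤ dist (T x) (T y)) (A : Set E) :
    μ A ≤ μ (T '' A) := by
  have : (μH[(Module.finrank ℝ E : ℝ)] : Measure E).IsAddHaarMeasure :=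
    isAddHaarMeasure_hausdorffMeasure
  rw [Measure.isAddLeftInvariant_eq_smul μ (μH[(Module.finrank ℝ E : ℝ)])]
  have h : AntilipschitzWith 1 T := AntilipschitzWith.of_le_mul_dist (by simpa using hT)
  have := h.le_hausdorffMeasure_image (d := (Module.finrank ℝ E : ℝ)) (by positivity) A
  rw [ENNReal.coe_one, ENNReal.one_rpow, one_mul] at this
  simp only [Measure.smul_apply]
  gcongr

/-- The part of the outer `ε`-shell of a convex set `Q` inside a convex set `L` is at most as
large as the outer `ε`-shell of `L`. -/
theorem Convex.addHaar_shell_inter_le (μ : Measure E) [μ.IsAddHaarMeasure] {Q L : Set E}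
    (hQ : Convex ℝ Q) (hL : Convex ℝ L) (hLf : μ L ≠ ∞) {ε : ℝ} (hε : 0 < ε) :
    μ (((Q + ε • Metric.closedBall (0 : E) 1) \ Q) ∩ L) ≤
      μ ((L + ε • Metric.closedBall (0 : E) 1) \ L) := by
  rcases Q.eq_empty_or_nonempty with rfl | hne
  · simp
  obtain ⟨T, hT1, hT2, hT3⟩ := hQ.closure.exists_expanding_map isClosed_closure hne.closure hε.le
  set L' := L + ε • Metric.closedBall (0 : E) 1 with hL'
  set d : E → ℝ := fun x => Metric.infDist x (closure Q) with hd
  set S : ℕ → Set E := fun k => d ⁻¹' Set.Ioc (k * ε) ((k + 1) * ε) with hS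
  have hSm : ∀ k, MeasurableSet (S k) := fun k =>
    (Metric.continuous_infDist_pt _).measurable measurableSet_Ioc
  have hSd : Pairwise (Function.onFun Disjoint S) := by
    have key : ∀ i j : ℕ, i < j → Disjoint (S i) (S j) := fun i j hij => by
      rw [Set.disjoint_left]
      intro x hi hj
      have h1 : ((i : ℝ) + 1) ≤ j := by exact_mod_cast hij
      have h2 := hi.2
      have h3 := hj.1
      nlinarith
    intro i j hij
    rcases lt_or_gt_of_ne hij with h | h
    · exact key i j h
    · exact (key j i h).symm
  have hLm : NullMeasurableSet L μ := hL.nullMeasurableSet μ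
  have hL'c : Convex ℝ L' := hL.add ((convex_closedBall _ _).smul _)
  have hL'm : NullMeasurableSet L' μ := hL'c.nullMeasurableSet μ
  set a : ℕ → ℝ≥0∞ := fun k => μ (L ∩ S k) with ha
  set b : ℕ → ℝ≥0∞ := fun k => μ ((L' \ L) ∩ S k) with hb
  -- The expanding map sends the `k`-th distance layer of `L` into the next layer of `L'`. The image
  -- either stays in `L` or falls into the shell of `L`.
  have hstep : ∀ k, a k ≤ a (k + 1) + b (k + 1) := by
    intro k
    have hsub : T '' (L ∩ S k) ⊆ (L ∩ S (k + 1)) ∪ ((L' \ L) ∩ S (k + 1)) := by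
      rintro _ ⟨x, ⟨hxL, hxS⟩, rfl⟩
      have hx0 : 0 < d x := lt_of_le_of_lt (by positivity) hxS.1
      have hTS : T x ∈ S (k + 1) := by
        have h3 : d (T x) = d x + ε := hT3 x hx0
        simp only [hS, Set.mem_preimage, Set.mem_Ioc, h3, Nat.cast_add, Nat.cast_one]
        have h1 := hxS.1
        have h2 := hxS.2
        constructor <;> nlinarith
      have hTL : T x ∈ L' := by
        refine ⟨x, hxL, T x - x, ?_, add_sub_cancel x (T x)⟩
        rw [smul_unitClosedBall, Real.norm_of_nonneg hε.le, mem_closedBall_zero_iff]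
        exact hT1 x
      by_cases h : T x ∈ L
      · exact Or.inl ⟨h, hTS⟩
      · exact Or.inr ⟨⟨hTL, h⟩, hTS⟩
    exact (Measure.addHaar_le_addHaar_image_of_expanding μ hT2 _).trans
      ((measure_mono hsub).trans (measure_union_le _ _))
  have hiter : ∀ m, a 0 ≤ a m + ∑ k ∈ Finset.range m, b (k + 1) := by
    intro m
    induction m with
    | zero => simp
    | succ m ih =>
      rw [Finset.sum_range_succ]
      calc a 0 ≤ a m + ∑ k ∈ Finset.range m, b (k + 1) := ih
        _ ≤ (a (m + 1) + b (m + 1)) + ∑ k ∈ Finset.range m, b (k + 1) := by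
          gcongr; exact hstep m
        _ = _ := by ring
  have hasum : ∑' k, a k ≤ μ L := by
    rw [← measure_iUnion₀ (fun i j hij => (Disjoint.aedisjoint
      ((hSd hij).mono Set.inter_subset_right Set.inter_subset_right)))
      (fun k => hLm.inter (hSm k).nullMeasurableSet)]
    exact measure_mono (Set.iUnion_subset fun k => Set.inter_subset_left)
  have hbsum : ∑' k, b (k + 1) ≤ μ (L' \ L) := by
    rw [← measure_iUnion₀ (fun i j hij => (Disjoint.aedisjoint
      ((hSd (fun h => hij (Nat.succ_injective h))).mono Set.inter_subset_right
        Set.inter_subset_right)))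
      (fun k => (hL'm.diff hLm).inter (hSm _).nullMeasurableSet)]
    exact measure_mono (Set.iUnion_subset fun k => Set.inter_subset_left)
  -- Finite volume of `L` makes the remainder in the telescoped inequality vanish, so `L` may be
  -- unbounded.
  have ha0 : Tendsto a atTop (𝓝 0) :=
    ENNReal.tendsto_atTop_zero_of_tsum_ne_top (ne_top_of_le_ne_top hLf hasum)
  have hfin : a 0 ≤ μ (L' \ L) := by
    have h1 : ∀ m, a 0 ≤ a m + μ (L' \ L) := fun m =>
      (hiter m).trans (by gcongr; exact (ENNReal.sum_le_tsum _).trans hbsum)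
    have h2 : Tendsto (fun m => a m + μ (L' \ L)) atTop (𝓝 (0 + μ (L' \ L))) :=
      ha0.add tendsto_const_nhds
    rw [zero_add] at h2
    exact ge_of_tendsto' h2 h1
  refine le_trans ?_ hfin
  -- `Q` need not be closed; the discrepancy lies in its frontier, which is null by convexity.
  have hsub : ((Q + ε • Metric.closedBall (0 : E) 1) \ Q) ∩ L ⊆ (L ∩ S 0) ∪ frontier Q := by
    rintro x ⟨⟨⟨q, hq, v, hv, rfl⟩, hxQ⟩, hxL⟩
    simp only at hxQ hxL ⊢
    by_cases h : q + v ∈ closure Q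
    · exact Or.inr ⟨h, fun h' => hxQ (interior_subset h')⟩
    · refine Or.inl ⟨hxL, ?_⟩
      simp only [hS, Set.mem_preimage, Set.mem_Ioc, Nat.cast_zero, zero_mul, zero_add, one_mul]
      refine ⟨(isClosed_closure.notMem_iff_infDist_pos hne.closure).1 h, ?_⟩
      rw [smul_unitClosedBall, Real.norm_of_nonneg hε.le, mem_closedBall_zero_iff] at hv
      refine (Metric.infDist_le_dist_of_mem (subset_closure hq)).trans ?_
      simpa [dist_eq_norm] using hv
  refine (measure_mono hsub).trans ((measure_union_le _ _).trans ?_)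
  rw [hQ.addHaar_frontier μ, add_zero]

/-- For `‖v‖ ≤ ε` the point `y + (ρ/ε)v` lies in the inner ball, so `x + v` is the image under the
homothety about `y` with ratio `1 + ε/ρ` of a convex combination of two points of `L`. -/
theorem Convex.addHaar_shell_le (μ : Measure E) [μ.IsAddHaarMeasure] {L : Set E}
    (hL : Convex ℝ L) (hLf : μ L ≠ ∞) {y : E} {ρ : ℝ} (hρ : 0 < ρ)
    (hball : Metric.closedBall y ρ ⊆ L) {ε : ℝ} (hε : 0 < ε) :
    μ ((L + ε • Metric.closedBall (0 : E) 1) \ L) ≤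
      ENNReal.ofReal ((1 + ε / ρ) ^ Module.finrank ℝ E - 1) * μ L := by
  have hsub : L + ε • Metric.closedBall (0 : E) 1 ⊆ AffineMap.homothety y (1 + ε / ρ) '' L := by
    rintro _ ⟨x, hx, v, hv, rfl⟩
    rw [smul_unitClosedBall, Real.norm_of_nonneg hε.le, mem_closedBall_zero_iff] at hv
    have hs : 0 < 1 + ε / ρ := by positivity
    have hz : y + (ρ / ε) • v ∈ L := hball (by
      rw [Metric.mem_closedBall, dist_eq_norm, add_sub_cancel_left, norm_smul,
        Real.norm_of_nonneg (by positivity)]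
      calc ρ / ε * ‖v‖ ≤ ρ / ε * ε := by gcongr
        _ = ρ := by field_simp)
    refine ⟨(1 + ε / ρ)⁻¹ • x + ((ε / ρ) * (1 + ε / ρ)⁻¹) • (y + (ρ / ε) • v),
      hL hx hz (by positivity) (by positivity) (by field_simp), ?_⟩
    rw [AffineMap.homothety_apply, vsub_eq_sub, vadd_eq_add]
    have e1 : (ε / ρ) * (1 + ε / ρ)⁻¹ * (ρ / ε) = (1 + ε / ρ)⁻¹ := by
      field_simp
    have e2 : (1 + ε / ρ) * (1 + ε / ρ)⁻¹ = 1 := mul_inv_cancel₀ hs.ne'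
    have e3 : (1 + ε / ρ) * ((ε / ρ) * (1 + ε / ρ)⁻¹) = ε / ρ := by
      field_simp
    rw [smul_add, smul_smul, e1]
    simp only [smul_add, smul_sub, smul_smul, e2, e3]
    module
  have hv : μ (L + ε • Metric.closedBall (0 : E) 1) ≤
      ENNReal.ofReal ((1 + ε / ρ) ^ Module.finrank ℝ E) * μ L := by
    refine (measure_mono hsub).trans ?_
    rw [Measure.addHaar_image_homothety, abs_of_nonneg (by positivity)]
  have hLL : L ⊆ L + ε • Metric.closedBall (0 : E) 1 := fun x hx =>
    ⟨x, hx, 0, ⟨0, by simp, by simp⟩, by simp⟩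
  rw [measure_sdiff hLL (hL.nullMeasurableSet μ) hLf, ENNReal.ofReal_sub _ zero_le_one,
    ENNReal.ofReal_one, ENNReal.sub_mul (fun _ _ => hLf), one_mul]
  exact tsub_le_tsub_right hv _

end Perimeter

/-! ### Log-concave densities and the perimeter bound. -/

section Density

variable {n : ℕ} {f g : EuclideanSpace ℝ (Fin n) → ℝ} {μ : Measure (EuclideanSpace ℝ (Fin n))}

theorem Convex.interior_nonempty_of_addHaar_ne_zero {B : Set (EuclideanSpace ℝ (Fin n))}
    (hB : Convex ℝ B) (h : volume B ≠ 0) : (interior B).Nonempty := by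
  by_contra hne
  rw [Set.not_nonempty_iff_eq_empty] at hne
  refine h (measure_mono_null ?_ (hB.addHaar_frontier volume))
  rw [frontier, hne, Set.sdiff_empty]
  exact subset_closure

/-- The part of `interior A` outside `closure B` is open and null, hence empty. This lets statements
about level sets pass between densities that agree only almost everywhere. -/
theorem Convex.interior_subset_interior_of_volume_diff {A B : Set (EuclideanSpace ℝ (Fin n))}
    (hB : Convex ℝ B) (h : volume (A \ B) = 0) : interior A ⊆ interior B := by
  rcases (interior A).eq_empty_or_nonempty with hA | hA
  · simp [hA]
  have hB0 : volume B ≠ 0 := fun h0 => by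
    have h1 : volume A ≤ volume (A \ B) + volume B := by
      refine (measure_mono ?_).trans (measure_union_le _ _)
      rw [Set.sdiff_union_self]
      exact Set.subset_union_left
    rw [h, h0, add_zero, nonpos_iff_eq_zero] at h1
    exact (Measure.measure_pos_of_nonempty_interior volume hA).ne' h1
  rw [← hB.interior_closure_eq_interior_of_nonempty_interior
    (hB.interior_nonempty_of_addHaar_ne_zero hB0)]
  refine interior_maximal ?_ isOpen_interior
  by_contra hsub
  rw [Set.not_subset] at hsub
  obtain ⟨x, hx, hxB⟩ := hsub
  have ho : IsOpen (interior A ∩ (closure B)ᶜ) := isOpen_interior.inter isClosed_closure.isOpen_compl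
  refine (ho.measure_pos volume ⟨x, hx, hxB⟩).ne' (measure_mono_null ?_ h)
  exact fun y hy => ⟨interior_subset hy.1, fun h' => hy.2 (subset_closure h')⟩

namespace IsLogConcaveDensity

theorem le_apply_homothety (hf : IsLogConcaveDensity f μ) (x y : EuclideanSpace ℝ (Fin n)) {c : ℝ}
    (h0 : 0 ≤ c) (h1 : c ≤ 1) :
    f x ^ (1 - c) * f y ^ c ≤ f (AffineMap.homothety x c y) := by
  have := hf.logConcave x y (1 - c) (by linarith) (by linarith)
  rw [sub_sub_cancel] at this
  convert this using 2
  rw [AffineMap.homothety_apply, vsub_eq_sub, vadd_eq_add]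
  module

theorem convex_levelSet (hf : IsLogConcaveDensity f μ) {t : ℝ} (ht : 0 < t) :
    Convex ℝ (levelSet f t) := by
  intro x hx y hy a b ha hb hab
  obtain rfl : b = 1 - a := by linarith
  refine le_trans ?_ (hf.logConcave x y a ha (by linarith))
  calc t = t ^ a * t ^ (1 - a) := by rw [← Real.rpow_add ht]; simp
    _ ≤ f x ^ a * f y ^ (1 - a) :=
      mul_le_mul (Real.rpow_le_rpow ht.le hx ha) (Real.rpow_le_rpow ht.le hy hb)
        (by positivity) (Real.rpow_nonneg (hf.nonneg x) _)

theorem nullMeasurableSet_levelSet (hf : IsLogConcaveDensity f μ) (t : ℝ) :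
    NullMeasurableSet (levelSet f t) volume := by
  rcases le_or_gt t 0 with ht | ht
  · have : levelSet f t = Set.univ := Set.eq_univ_of_forall fun x => ht.trans (hf.nonneg x)
    rw [this]
    exact nullMeasurableSet_univ
  · exact (hf.convex_levelSet ht).nullMeasurableSet volume

theorem aemeasurable (hf : IsLogConcaveDensity f μ) : AEMeasurable f volume := by
  refine NullMeasurable.aemeasurable ?_
  exact measurable_of_Ici (δ := NullMeasurableSpace (EuclideanSpace ℝ (Fin n)) volume)
    fun t => hf.nullMeasurableSet_levelSet t

theorem apply_eq (hf : IsLogConcaveDensity f μ) (S : Set (EuclideanSpace ℝ (Fin n))) :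
    μ S = ∫⁻ x in S, ENNReal.ofReal (f x) := by
  rw [hf.eq_withDensity, withDensity_apply']

theorem lintegral_eq_one [IsProbabilityMeasure μ] (hf : IsLogConcaveDensity f μ) :
    ∫⁻ x, ENNReal.ofReal (f x) = 1 := by
  rw [← setLIntegral_univ, ← hf.apply_eq, measure_univ]

theorem absolutelyContinuous (hf : IsLogConcaveDensity f μ) : μ ≪ volume := by
  rw [hf.eq_withDensity]
  exact withDensity_absolutelyContinuous _ _

theorem ae_eq [IsProbabilityMeasure μ] (hf : IsLogConcaveDensity f μ)
    (hg : IsLogConcaveDensity g μ) : f =ᵐ[volume] g := by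
  have h := (withDensity_eq_iff hf.aemeasurable.ennreal_ofReal hg.aemeasurable.ennreal_ofReal
    (by rw [hf.lintegral_eq_one]; simp)).1 (hf.eq_withDensity.symm.trans hg.eq_withDensity)
  filter_upwards [h] with x hx
  rwa [ENNReal.ofReal_eq_ofReal_iff (hf.nonneg x) (hg.nonneg x)] at hx

theorem ofReal_mul_volume_levelSet_le [IsProbabilityMeasure μ] (hf : IsLogConcaveDensity f μ)
    (t : ℝ) : ENNReal.ofReal t * volume (levelSet f t) ≤ 1 := by
  rw [← hf.lintegral_eq_one]
  refine le_trans ?_ (mul_meas_ge_le_lintegral₀ hf.aemeasurable.ennreal_ofReal (ENNReal.ofReal t))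
  gcongr
  exact fun x hx => ENNReal.ofReal_le_ofReal hx

theorem volume_levelSet_ne_top [IsProbabilityMeasure μ] (hf : IsLogConcaveDensity f μ)
    {t : ℝ} (ht : 0 < t) : volume (levelSet f t) ≠ ∞ := by
  intro h
  have := hf.ofReal_mul_volume_levelSet_le t
  rw [h, ENNReal.mul_top (by simpa using ht)] at this
  simp at this

theorem exists_levelSet_volume_pos [IsProbabilityMeasure μ] (hf : IsLogConcaveDensity f μ) :
    ∃ a : ℝ, 0 < a ∧ volume (levelSet f a) ≠ 0 := by
  by_contra! h
  have h0 : ∀ᵐ x, f x ≤ 0 := by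
    have : {x | ¬ f x ≤ 0} ⊆ ⋃ k : ℕ, levelSet f (1 / ((k : ℝ) + 1)) := fun x hx => by
      obtain ⟨k, hk⟩ := exists_nat_one_div_lt (not_le.1 hx)
      exact Set.mem_iUnion.2 ⟨k, hk.le⟩
    exact measure_mono_null this (measure_iUnion_null fun k => h _ (by positivity))
  have h1 := hf.lintegral_eq_one
  rw [lintegral_congr_ae (g := fun _ => 0)
    (by filter_upwards [h0] with x hx using ENNReal.ofReal_of_nonpos hx)] at h1
  simp at h1

/-- Halving a level set of positive volume towards `x` gives a set of fixed volume on which `f ≥ √(f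
x · a)`. Total mass one then bounds `f x`. -/
theorem exists_forall_le [IsProbabilityMeasure μ] (hf : IsLogConcaveDensity f μ) :
    ∃ C : ℝ, ∀ x, f x ≤ C := by
  obtain ⟨a, ha, hv⟩ := hf.exists_levelSet_volume_pos
  set c : ℝ := (1 / 2 : ℝ) ^ n * (volume (levelSet f a)).toReal with hc
  have hc0 : 0 < c := mul_pos (by positivity) (ENNReal.toReal_pos hv (hf.volume_levelSet_ne_top ha))
  refine ⟨(1 / c) ^ 2 / a, fun x => ?_⟩
  rcases (hf.nonneg x).eq_or_lt with h0 | h0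
  · rw [← h0]; positivity
  set s : ℝ := f x ^ (1 / 2 : ℝ) * a ^ (1 / 2 : ℝ) with hs
  have hs0 : 0 < s := by positivity
  have hs2 : s ^ 2 = f x * a := by
    rw [hs, mul_pow, ← Real.rpow_natCast, ← Real.rpow_natCast, ← Real.rpow_mul h0.le,
      ← Real.rpow_mul ha.le]
    norm_num
  have hsub : AffineMap.homothety x (1 / 2 : ℝ) '' levelSet f a ⊆ levelSet f s := by
    rintro _ ⟨y, hy, rfl⟩
    have := hf.le_apply_homothety x y (c := 1 / 2) (by norm_num) (by norm_num)
    refine le_trans ?_ this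
    rw [hs]
    norm_num
    exact mul_le_mul_of_nonneg_left (Real.rpow_le_rpow ha.le hy (by norm_num)) (by positivity)
  have hvol : ENNReal.ofReal c ≤ volume (levelSet f s) := by
    refine le_trans (le_of_eq ?_) (measure_mono hsub)
    rw [Measure.addHaar_image_homothety, hc, ENNReal.ofReal_mul (by positivity),
      ENNReal.ofReal_toReal (hf.volume_levelSet_ne_top ha), finrank_euclideanSpace_fin,
      abs_of_nonneg (by positivity)]
  have h1 : ENNReal.ofReal s * ENNReal.ofReal c ≤ 1 :=
    le_trans (by gcongr) (hf.ofReal_mul_volume_levelSet_le s)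
  rw [← ENNReal.ofReal_mul hs0.le, ENNReal.ofReal_le_one, ← le_div_iff₀ hc0] at h1
  rw [le_div_iff₀ ha, ← hs2]
  gcongr

/-- The essential supremum is a pointwise bound: a larger value at `x` would, by log-concavity,
persist on a small homothetic copy about `x` of a level set of positive volume. -/
theorem exists_eLpNorm_eq [IsProbabilityMeasure μ] (hf : IsLogConcaveDensity f μ) :
    ∃ M : ℝ, 0 < M ∧ eLpNorm f ∞ volume = ENNReal.ofReal M ∧ ∀ x, f x ≤ M := by
  obtain ⟨C, hC⟩ := hf.exists_forall_le
  obtain ⟨a, ha, hv⟩ := hf.exists_levelSet_volume_pos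
  have hfin : eLpNorm f ∞ volume ≠ ∞ := by
    rw [eLpNorm_exponent_top]
    refine ne_top_of_le_ne_top ENNReal.ofReal_ne_top (eLpNormEssSup_le_of_ae_bound (C := C) ?_)
    filter_upwards with x
    rw [Real.norm_of_nonneg (hf.nonneg x)]
    exact hC x
  have hae : ∀ᵐ x, f x ≤ (eLpNorm f ∞ volume).toReal := by
    filter_upwards [ae_le_eLpNormEssSup (f := f) (μ := volume)] with x hx
    rw [← ENNReal.ofReal_le_iff_le_toReal hfin, eLpNorm_exponent_top,
      ← Real.enorm_of_nonneg (hf.nonneg x)]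
    exact hx
  refine ⟨(eLpNorm f ∞ volume).toReal, ?_, (ENNReal.ofReal_toReal hfin).symm, fun x => ?_⟩
  · by_contra! h
    refine hv (measure_mono_null (fun x hx => ?_) hae)
    have h1 : a ≤ f x := hx
    simp only [Set.mem_compl_iff, Set.mem_ofPred_eq, not_le]
    linarith
  · by_contra! h
    have h0 : 0 < f x := lt_of_le_of_lt ENNReal.toReal_nonneg h
    have hcont : ContinuousAt (fun c : ℝ => f x ^ (1 - c) * a ^ c) 0 := by
      have h1 : Continuous fun c : ℝ => f x ^ (1 - c) :=
        (Real.continuous_const_rpow h0.ne').comp (continuous_const.sub continuous_id)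
      exact (h1.mul (Real.continuous_const_rpow ha.ne')).continuousAt
    have hev : ∀ᶠ c in 𝓝[>] (0 : ℝ), (eLpNorm f ∞ volume).toReal < f x ^ (1 - c) * a ^ c := by
      refine (hcont.tendsto.mono_left nhdsWithin_le_nhds).eventually (lt_mem_nhds ?_)
      simpa using h
    obtain ⟨c, hc1, hc2⟩ := (hev.and (Ioc_mem_nhdsGT (zero_lt_one' ℝ))).exists
    refine (?_ : volume (AffineMap.homothety x c '' levelSet f a) ≠ 0)
      (measure_mono_null ?_ hae)
    · rw [Measure.addHaar_image_homothety]
      refine mul_ne_zero ?_ hv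
      simpa using fun h => absurd h hc2.1.ne'
    · rintro _ ⟨y, hy, rfl⟩
      simp only [Set.mem_compl_iff, Set.mem_ofPred_eq, not_le]
      refine hc1.trans_le (le_trans ?_ (hf.le_apply_homothety x y hc2.1.le hc2.2))
      exact mul_le_mul_of_nonneg_left (Real.rpow_le_rpow ha.le hy hc2.1.le) (by positivity)

theorem levelSet_eq_empty {M t : ℝ} (hM : ∀ x, f x ≤ M) (ht : M < t) : levelSet f t = ∅ :=
  Set.eq_empty_of_forall_notMem fun x hx => absurd (hM x) (not_le.2 (ht.trans_le hx))

/-- In the layer-cake integral, levels up to `t` contribute at most the total mass, giving the `1`.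
Levels in `(t, M]` contribute at most `M |K_t|`, giving the `C`. -/
theorem measure_shell_le [IsProbabilityMeasure μ] (hf : IsLogConcaveDensity f μ) {M C t ρ : ℝ}
    (hM : 0 < M) (hfM : ∀ x, f x ≤ M) (hC : 0 ≤ C) (ht : 0 < t) (hρ : 0 < ρ)
    (hvol : volume (levelSet f t) ≤ ENNReal.ofReal C / ENNReal.ofReal M)
    {y : EuclideanSpace ℝ (Fin n)} (hball : Metric.closedBall y ρ ⊆ levelSet f t)
    {Q : Set (EuclideanSpace ℝ (Fin n))} (hQ : Convex ℝ Q) {ε : ℝ} (hε : 0 < ε) :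
    μ ((Q + ε • Metric.closedBall 0 1) \ Q) ≤
      ENNReal.ofReal ((1 + ε / ρ) ^ n - 1) * ENNReal.ofReal (1 + C) := by
  set D := (Q + ε • Metric.closedBall (0 : EuclideanSpace ℝ (Fin n)) 1) \ Q with hD
  set G := ENNReal.ofReal ((1 + ε / ρ) ^ n - 1) with hG
  have hDm : NullMeasurableSet D volume :=
    ((hQ.add ((convex_closedBall _ _).smul _)).nullMeasurableSet volume).diff
      (hQ.nullMeasurableSet volume)
  have hcore : ∀ s, 0 < s → s ≤ t → volume (D ∩ levelSet f s) ≤ G * volume (levelSet f s) := by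
    intro s hs hst
    have hb : Metric.closedBall y ρ ⊆ levelSet f s := hball.trans fun x hx => hst.trans hx
    refine (hQ.addHaar_shell_inter_le volume (hf.convex_levelSet hs)
      (hf.volume_levelSet_ne_top hs) hε).trans ?_
    have := (hf.convex_levelSet hs).addHaar_shell_le volume (hf.volume_levelSet_ne_top hs) hρ hb hε
    rwa [finrank_euclideanSpace_fin] at this
  have hpt : ∀ s ∈ Set.Ioi (0 : ℝ), volume.restrict D {x | s ≤ f x} ≤
      G * volume {x | s ≤ f x} +
        (Set.Ioc 0 M).indicator (fun _ => G * volume (levelSet f t)) s := by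
    intro s hs
    rw [Measure.restrict_apply₀' hDm, Set.inter_comm]
    rcases le_or_gt s t with h | h
    · exact (hcore s hs h).trans le_self_add
    rcases le_or_gt s M with h' | h'
    · rw [Set.indicator_of_mem (show s ∈ Set.Ioc 0 M from ⟨hs, h'⟩)]
      refine le_trans ?_ le_add_self
      refine le_trans (measure_mono ?_) (hcore t ht le_rfl)
      exact Set.inter_subset_inter_right _ fun x hx => h.le.trans hx
    · have : {x | s ≤ f x} = ∅ := levelSet_eq_empty hfM h'
      simp [this]
  rw [hf.apply_eq, lintegral_eq_lintegral_meas_le _ (by filter_upwards with x using hf.nonneg x)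
    (hf.aemeasurable.restrict)]
  refine (setLIntegral_mono' measurableSet_Ioi hpt).trans ?_
  rw [lintegral_add_right _ (measurable_const.indicator measurableSet_Ioc),
    lintegral_const_mul' _ _ ENNReal.ofReal_ne_top, ← lintegral_eq_lintegral_meas_le _
      (by filter_upwards with x using hf.nonneg x) hf.aemeasurable, hf.lintegral_eq_one,
    lintegral_indicator measurableSet_Ioc, Measure.restrict_restrict measurableSet_Ioc,
    setLIntegral_const, ENNReal.ofReal_add zero_le_one hC, mul_add, ENNReal.ofReal_one, mul_assoc]
  gcongr
  rw [Set.inter_eq_left.2 (fun x hx => hx.1), Real.volume_Ioc, sub_zero]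
  rw [ENNReal.le_div_iff_mul_le (Or.inl (by simpa using hM)) (Or.inl ENNReal.ofReal_ne_top)] at hvol
  exact hvol

/-- Dividing the shell bound by `ε` gives a difference quotient at zero, whose limit is the stated
constant. -/
theorem maxPerimeter_le [IsProbabilityMeasure μ] (hf : IsLogConcaveDensity f μ) {C t ρ : ℝ}
    (hC : 0 ≤ C) (ht : 0 < t) (hρ : 0 < ρ)
    (hvol : volume (levelSet f t) ≤ ENNReal.ofReal C / eLpNorm f ∞ volume)
    {y : EuclideanSpace ℝ (Fin n)} (hball : Metric.closedBall y ρ ⊆ levelSet f t) :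
    maxPerimeter μ ≤ ENNReal.ofReal ((1 + C) / ρ * n) := by
  obtain ⟨M, hM, hMe, hfM⟩ := hf.exists_eLpNorm_eq
  rw [hMe] at hvol
  refine iSup₂_le fun Q hQ => ?_
  have hder : HasDerivAt (fun ε : ℝ => (1 + ε / ρ) ^ n * (1 + C)) ((1 + C) / ρ * n) 0 := by
    have h1 : HasDerivAt (fun ε : ℝ => 1 + ε / ρ) (1 / ρ) 0 :=
      ((hasDerivAt_id (0 : ℝ)).div_const ρ).const_add 1
    refine ((h1.fun_pow n).mul_const (1 + C)).congr_deriv ?_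
    rw [zero_div, add_zero, one_pow]
    ring
  have hlim : Tendsto (fun ε : ℝ => ENNReal.ofReal (((1 + ε / ρ) ^ n - 1) * (1 + C) / ε)) (𝓝[>] 0)
      (𝓝 (ENNReal.ofReal ((1 + C) / ρ * n))) := by
    refine ENNReal.tendsto_ofReal ?_
    have := hder.tendsto_slope_zero_right
    refine this.congr fun ε => ?_
    simp
    ring
  refine le_trans (liminf_le_liminf ?_) hlim.liminf_eq.le
  filter_upwards [self_mem_nhdsWithin] with ε hε
  have hε : 0 < ε := hε
  have h0 : (0 : ℝ) ≤ (1 + ε / ρ) ^ n - 1 := sub_nonneg.2 (one_le_pow₀ (by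
    have : 0 < ε / ρ := by positivity
    linarith))
  rw [ENNReal.ofReal_div_of_pos hε, ENNReal.ofReal_mul h0]
  gcongr
  exact hf.measure_shell_le hM hfM hC ht hρ hvol hball hQ hε

end IsLogConcaveDensity

end Density

/-! ### Two comparable levels of a log-concave density. -/

section Levels

variable {n : ℕ} {f : EuclideanSpace ℝ (Fin n) → ℝ} {μ : Measure (EuclideanSpace ℝ (Fin n))}

namespace IsLogConcaveDensity

theorem exists_lt_apply (hf : IsLogConcaveDensity f μ) {M c : ℝ}
    (hMe : eLpNorm f ∞ volume = ENNReal.ofReal M) (hc0 : 0 ≤ c) (hc : c < M) : ∃ x, c < f x := by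
  by_contra! h
  have h1 : eLpNorm f ∞ volume ≤ ENNReal.ofReal c := by
    rw [eLpNorm_exponent_top]
    refine eLpNormEssSup_le_of_ae_bound ?_
    filter_upwards with x
    rw [Real.norm_of_nonneg (hf.nonneg x)]
    exact h x
  rw [hMe, ENNReal.ofReal_le_ofReal_iff hc0] at h1
  linarith

theorem lintegral_comp_homothety_half (f : EuclideanSpace ℝ (Fin n) → ℝ≥0∞)
    (x₀ : EuclideanSpace ℝ (Fin n)) :
    ∫⁻ x, f (AffineMap.homothety x₀ (1 / 2 : ℝ) x) = 2 ^ n * ∫⁻ x, f x := by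
  have h1 : ∀ x, f (AffineMap.homothety x₀ (1 / 2 : ℝ) x) =
      f ((1 / 2 : ℝ) • x + (1 / 2 : ℝ) • x₀) := fun x => by
    congr 1
    rw [AffineMap.homothety_apply, vsub_eq_sub, vadd_eq_add]
    module
  simp_rw [h1]
  have h2 : ∫⁻ x, f ((1 / 2 : ℝ) • x + (1 / 2 : ℝ) • x₀) =
      ∫⁻ x, f (x + (1 / 2 : ℝ) • x₀) ∂(volume.map ((1 / 2 : ℝ) • ·)) :=
    ((measurableEmbedding_const_smul₀ (by norm_num : (1 / 2 : ℝ) ≠ 0)).lintegral_map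
      (fun x => f (x + (1 / 2 : ℝ) • x₀))).symm
  rw [h2, Measure.map_addHaar_smul _ (by norm_num), lintegral_smul_measure,
    lintegral_add_right_eq_self f, finrank_euclideanSpace_fin, smul_eq_mul]
  congr 1
  rw [abs_of_nonneg (by positivity), ← inv_pow, ENNReal.ofReal_pow (by norm_num)]
  norm_num

/-- Where `f x < t`, write `f x = √(f x) · √(f x)`, bound one root by `√t`, and compare the other
with the value of `f` midway between `x` and a near-maximum point `x₀`. The change of variables
costs `2^n`; taking `f x₀ > M/4` costs the extra factor 2. -/
theorem measure_lt_le [IsProbabilityMeasure μ] (hf : IsLogConcaveDensity f μ) {M t : ℝ}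
    (hM : 0 < M) (hMe : eLpNorm f ∞ volume = ENNReal.ofReal M) (ht : 0 < t) :
    μ {x | f x < t} ≤ ENNReal.ofReal (2 ^ (n + 1) * √(t / M)) := by
  obtain ⟨x₀, hx₀⟩ := hf.exists_lt_apply hMe (c := M / 4) (by linarith) (by linarith)
  have hm : NullMeasurableSet {x | f x < t} volume := by
    have : {x | f x < t} = (levelSet f t)ᶜ := by ext x; simp [levelSet]
    rw [this]
    exact (hf.nullMeasurableSet_levelSet t).compl
  have hpt : ∀ x, f x < t → ENNReal.ofReal (f x) ≤ ENNReal.ofReal (2 * √(t / M)) *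
      ENNReal.ofReal (f (AffineMap.homothety x₀ (1 / 2 : ℝ) x)) := by
    intro x hx
    rw [← ENNReal.ofReal_mul (by positivity)]
    refine ENNReal.ofReal_le_ofReal ?_
    have h1 := hf.le_apply_homothety x₀ x (c := 1 / 2) (by norm_num) (by norm_num)
    norm_num only at h1
    rw [← Real.sqrt_eq_rpow, ← Real.sqrt_eq_rpow] at h1
    have h2 : √M ≤ 2 * √(f x₀) := by
      rw [show (2 : ℝ) = √4 by rw [show (4 : ℝ) = 2 ^ 2 by norm_num, Real.sqrt_sq (by norm_num)],
        ← Real.sqrt_mul (by norm_num)]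
      exact Real.sqrt_le_sqrt (by linarith)
    have h3 : √(f x) ≤ √t := Real.sqrt_le_sqrt hx.le
    have h4 : √M * √(t / M) = √t := by
      rw [← Real.sqrt_mul hM.le]
      congr 1
      field_simp
    calc f x = √(f x) * √(f x) := (Real.mul_self_sqrt (hf.nonneg x)).symm
      _ ≤ √t * √(f x) := by gcongr
      _ = √M * √(t / M) * √(f x) := by rw [h4]
      _ ≤ 2 * √(f x₀) * √(t / M) * √(f x) := by gcongr
      _ = 2 * √(t / M) * (√(f x₀) * √(f x)) := by ring
      _ ≤ _ := by gcongr
  rw [hf.apply_eq]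
  calc ∫⁻ x in {x | f x < t}, ENNReal.ofReal (f x)
      ≤ ∫⁻ x in {x | f x < t}, ENNReal.ofReal (2 * √(t / M)) *
        ENNReal.ofReal (f (AffineMap.homothety x₀ (1 / 2 : ℝ) x)) := by
        refine lintegral_mono_ae ?_
        filter_upwards [ae_restrict_mem₀ hm] with x hx using hpt x hx
    _ ≤ ∫⁻ x, ENNReal.ofReal (2 * √(t / M)) *
        ENNReal.ofReal (f (AffineMap.homothety x₀ (1 / 2 : ℝ) x)) := setLIntegral_le_lintegral _ _
    _ = ENNReal.ofReal (2 ^ (n + 1) * √(t / M)) := by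
        rw [lintegral_const_mul' _ _ ENNReal.ofReal_ne_top,
          lintegral_comp_homothety_half (fun x => ENNReal.ofReal (f x)), hf.lintegral_eq_one,
          mul_one, pow_succ, mul_assoc, ENNReal.ofReal_mul (p := 2 ^ n) (by positivity), mul_comm,
          ENNReal.ofReal_pow (by norm_num), ENNReal.ofReal_ofNat]

/-- Contract by one half towards a point where `f > M τ^(1/3)`, which exists even if the supremum is
not attained. The geometric mean of `τ^(1/3)` and `τ` is `τ^(2/3)`. -/
theorem volume_levelSet_le_rpow (hf : IsLogConcaveDensity f μ) {M τ : ℝ}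
    (hM : 0 < M) (hMe : eLpNorm f ∞ volume = ENNReal.ofReal M) (h0 : 0 < τ) (h1 : τ < 1) :
    volume (levelSet f (M * τ)) ≤ 2 ^ n * volume (levelSet f (M * τ ^ (2 / 3 : ℝ))) := by
  obtain ⟨x₀, hx₀⟩ := hf.exists_lt_apply hMe (c := M * τ ^ (1 / 3 : ℝ)) (by positivity)
    (mul_lt_of_lt_one_right hM (Real.rpow_lt_one h0.le h1 (by norm_num)))
  have hsub : AffineMap.homothety x₀ (1 / 2 : ℝ) '' levelSet f (M * τ) ⊆
      levelSet f (M * τ ^ (2 / 3 : ℝ)) := by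
    rintro _ ⟨x, hx, rfl⟩
    have h1 := hf.le_apply_homothety x₀ x (c := 1 / 2) (by norm_num) (by norm_num)
    refine le_trans ?_ h1
    have h2 : M * τ ^ (2 / 3 : ℝ) =
        (M * τ ^ (1 / 3 : ℝ)) ^ (1 - 1 / 2 : ℝ) * (M * τ) ^ (1 / 2 : ℝ) := by
      rw [Real.mul_rpow hM.le (by positivity), Real.mul_rpow hM.le h0.le, ← Real.rpow_mul h0.le]
      calc M * τ ^ (2 / 3 : ℝ) = M ^ (1 - 1 / 2 + 1 / 2 : ℝ) *
            τ ^ (1 / 3 * (1 - 1 / 2) + 1 / 2 : ℝ) := by norm_num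
        _ = _ := by rw [Real.rpow_add hM, Real.rpow_add h0]; ring
    rw [h2]
    have : M * τ ≤ f x := hx
    exact mul_le_mul (Real.rpow_le_rpow (by positivity) hx₀.le (by norm_num))
      (Real.rpow_le_rpow (by positivity) this (by norm_num)) (by positivity)
      (Real.rpow_nonneg (hf.nonneg _) _)
  have h3 := measure_mono (μ := volume) hsub
  rw [Measure.addHaar_image_homothety, finrank_euclideanSpace_fin, abs_of_nonneg (by positivity),
    ENNReal.ofReal_pow (by norm_num)] at h3
  calc volume (levelSet f (M * τ))
      = 2 ^ n * (ENNReal.ofReal (1 / 2) ^ n * volume (levelSet f (M * τ))) := by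
        have h2 : (2 : ℝ≥0∞) * ENNReal.ofReal (1 / 2) = 1 := by
          rw [← ENNReal.ofReal_ofNat 2, ← ENNReal.ofReal_mul (by norm_num)]
          norm_num
        rw [← mul_assoc, ← mul_pow, h2, one_pow, one_mul]
    _ ≤ _ := by gcongr

/-- Starting from the level that loses mass at most `δ`, relative heights are raised repeatedly to
the power `2/3` until the volume first drops to `2/‖f‖_∞`. The last step loses only `2^n`, so the
stopping set is not too small. -/
theorem exists_levels [IsProbabilityMeasure μ] (hn : 1 ≤ n) (hf : IsLogConcaveDensity f μ)
    {δ : ℝ} (hδ : 0 < δ) (hδ1 : δ ≤ 1) :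
    ∃ t₀ t₁ : ℝ, 0 < t₁ ∧ t₁ ≤ t₀ ∧ ENNReal.ofReal t₀ < eLpNorm f ∞ volume ∧
      μ (levelSet f t₁)ᶜ ≤ ENNReal.ofReal δ ∧
      volume (levelSet f t₀) ≤ ENNReal.ofReal 2 / eLpNorm f ∞ volume ∧
      volume (levelSet f t₁) ≤ ENNReal.ofReal ((16 / δ ^ 2) ^ n) * volume (levelSet f t₀) := by
  obtain ⟨M, hM, hMe, -⟩ := hf.exists_eLpNorm_eq
  -- Chosen so that the bound `2^(n+1) √τ` of `measure_lt_le` equals `δ`.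
  set τ : ℝ := (δ / 2 ^ (n + 1)) ^ 2 with hτ
  have hτ0 : 0 < τ := by positivity
  have hτ1 : τ < 1 := by
    have h2 : (1 : ℝ) < 2 ^ (n + 1) := one_lt_pow₀ (by norm_num) (by omega)
    refine pow_lt_one₀ (by positivity) ?_ (by norm_num)
    rw [div_lt_one (by positivity)]
    linarith
  set u : ℕ → ℝ := fun k => τ ^ ((2 / 3 : ℝ) ^ k) with hu
  have hu0 : ∀ k, 0 < u k := fun k => Real.rpow_pos_of_pos hτ0 _
  have hu1 : ∀ k, u k < 1 := fun k => Real.rpow_lt_one hτ0.le hτ1 (by positivity)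
  have huτ : ∀ k, τ ≤ u k := fun k => by
    simpa using Real.rpow_le_rpow_of_exponent_ge hτ0 hτ1.le
      (pow_le_one₀ (by norm_num) (by norm_num) : (2 / 3 : ℝ) ^ k ≤ 1)
  have hlim : Tendsto u atTop (𝓝 1) := by
    have := ((Real.continuous_const_rpow hτ0.ne').tendsto 0).comp
      (tendsto_pow_atTop_nhds_zero_of_lt_one (r := (2 / 3 : ℝ)) (by norm_num) (by norm_num))
    simpa [Function.comp_def] using this
  have hex : ∃ k, volume (levelSet f (M * u k)) ≤ ENNReal.ofReal (2 / M) := by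
    obtain ⟨k, hk⟩ := (hlim.eventually (lt_mem_nhds (show (1 / 2 : ℝ) < 1 by norm_num))).exists
    refine ⟨k, ?_⟩
    have h1 := hf.ofReal_mul_volume_levelSet_le (M * u k)
    rw [mul_comm, ← ENNReal.le_div_iff_mul_le
      (Or.inl (by simpa using mul_pos hM (hu0 k))) (Or.inl ENNReal.ofReal_ne_top)] at h1
    refine h1.trans ?_
    rw [← ENNReal.ofReal_one, ← ENNReal.ofReal_div_of_pos (mul_pos hM (hu0 k))]
    refine ENNReal.ofReal_le_ofReal ?_
    rw [div_le_div_iff₀ (mul_pos hM (hu0 k)) hM]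
    nlinarith
  classical
  set k := Nat.find hex with hk
  have hB : 1 ≤ 16 / δ ^ 2 := by
    rw [le_div_iff₀ (by positivity)]
    nlinarith
  refine ⟨M * u k, M * τ, by positivity, by gcongr; exact huτ k, ?_, ?_, ?_, ?_⟩
  · rw [hMe, ENNReal.ofReal_lt_ofReal_iff hM]
    exact mul_lt_of_lt_one_right hM (hu1 k)
  · have h1 := hf.measure_lt_le hM hMe (t := M * τ) (by positivity)
    have h2 : (levelSet f (M * τ))ᶜ = {x | f x < M * τ} := by ext x; simp [levelSet]
    rw [h2]
    refine h1.trans (ENNReal.ofReal_le_ofReal (le_of_eq ?_))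
    rw [mul_div_cancel_left₀ _ hM.ne', hτ, Real.sqrt_sq (by positivity)]
    field_simp
  · rw [hMe, ← ENNReal.ofReal_div_of_pos hM]
    exact Nat.find_spec hex
  · rcases Nat.eq_zero_or_pos k with h0 | h0
    · have : u k = τ := by simp [hu, h0]
      rw [this]
      refine le_mul_of_one_le_left' ?_
      rw [ENNReal.one_le_ofReal]
      exact one_le_pow₀ hB
    · have hmin := Nat.find_min hex (m := k - 1) (by omega)
      rw [not_le] at hmin
      have hstep := hf.volume_levelSet_le_rpow hM hMe (hu0 (k - 1)) (hu1 (k - 1))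
      have hrec : u (k - 1) ^ (2 / 3 : ℝ) = u k := by
        simp only [hu]
        rw [← Real.rpow_mul hτ0.le, ← pow_succ, Nat.sub_add_cancel h0]
      rw [hrec] at hstep
      have h1 := hf.ofReal_mul_volume_levelSet_le (M * τ)
      rw [mul_comm, ← ENNReal.le_div_iff_mul_le
        (Or.inl (by simpa using mul_pos hM hτ0)) (Or.inl ENNReal.ofReal_ne_top)] at h1
      calc volume (levelSet f (M * τ)) ≤ 1 / ENNReal.ofReal (M * τ) := h1
        _ = ENNReal.ofReal (1 / (2 * τ)) * ENNReal.ofReal (2 / M) := by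
          rw [← ENNReal.ofReal_one, ← ENNReal.ofReal_div_of_pos (by positivity),
            ← ENNReal.ofReal_mul (by positivity)]
          congr 1
          field_simp
        _ ≤ ENNReal.ofReal (1 / (2 * τ)) * (2 ^ n * volume (levelSet f (M * u k))) := by
          gcongr
          exact hmin.le.trans hstep
        _ = ENNReal.ofReal (1 / (2 * τ) * 2 ^ n) * volume (levelSet f (M * u k)) := by
          rw [← mul_assoc, ENNReal.ofReal_mul (by positivity), ENNReal.ofReal_pow (by norm_num),
            ENNReal.ofReal_ofNat]
        _ ≤ _ := by
          gcongr
          have e : 1 / (2 * τ) * 2 ^ n = (8 ^ n * 2) * (1 / δ ^ 2) := by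
            have h8 : (8 : ℝ) ^ n = 2 ^ n * 2 ^ n * 2 ^ n := by
              rw [← mul_pow, ← mul_pow]; norm_num
            rw [hτ, h8]
            field_simp
            ring
          have e' : (16 / δ ^ 2) ^ n = (8 ^ n * 2 ^ n) * (1 / δ ^ 2) ^ n := by
            rw [← mul_pow, ← mul_pow]; congr 1; ring
          have hδ2 : 1 ≤ 1 / δ ^ 2 := by
            rw [le_div_iff₀ (by positivity)]
            nlinarith
          rw [e, e']
          gcongr
          · exact le_self_pow₀ (by norm_num) (by omega)
          · exact le_self_pow₀ hδ2 (by omega)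

end IsLogConcaveDensity

end Levels

/-! ### Half-space mass of isotropic log-concave measures. -/

section Moments

variable {n : ℕ} {μ : Measure (EuclideanSpace ℝ (Fin n))}

namespace IsIsotropicMeasure

theorem integrable_inner_sq (hμ : IsIsotropicMeasure μ) {θ : EuclideanSpace ℝ (Fin n)}
    (hθ : ‖θ‖ = 1) : Integrable (fun x => (inner ℝ x θ) ^ 2) μ := by
  by_contra h
  have := hμ.second_moment θ hθ
  rw [integral_undef h] at this
  exact zero_ne_one this

theorem lintegral_inner_sq (hμ : IsIsotropicMeasure μ) {θ : EuclideanSpace ℝ (Fin n)}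
    (hθ : ‖θ‖ = 1) : ∫⁻ x, ENNReal.ofReal ((inner ℝ x θ) ^ 2) ∂μ = 1 := by
  rw [← ofReal_integral_eq_lintegral_ofReal (hμ.integrable_inner_sq hθ)
    (by filter_upwards with x using sq_nonneg _), hμ.second_moment θ hθ, ENNReal.ofReal_one]

theorem inner_single (x : EuclideanSpace ℝ (Fin n)) (i : Fin n) :
    inner ℝ x (EuclideanSpace.single i (1 : ℝ)) = x i := by
  simp [EuclideanSpace.inner_single_right]

theorem integrable_apply_sq (hμ : IsIsotropicMeasure μ) (i : Fin n) :
    Integrable (fun x : EuclideanSpace ℝ (Fin n) => x i ^ 2) μ := by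
  have := hμ.integrable_inner_sq (θ := EuclideanSpace.single i (1 : ℝ)) (by simp)
  simpa only [inner_single] using this

theorem integrable_id (hμ : IsIsotropicMeasure μ) :
    Integrable (fun x : EuclideanSpace ℝ (Fin n) => x) μ := by
  have := hμ.isProbabilityMeasure
  have h1 : Integrable (fun x : EuclideanSpace ℝ (Fin n) => 1 + ∑ i, x i ^ 2) μ :=
    (integrable_const 1).add (integrable_finsetSum _ fun i _ => hμ.integrable_apply_sq i)
  refine h1.mono' aestronglyMeasurable_id ?_
  filter_upwards with x
  have : ‖x‖ ^ 2 = ∑ i, x i ^ 2 := EuclideanSpace.real_norm_sq_eq x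
  rw [← this]
  nlinarith [sq_nonneg (‖x‖ - 1)]

theorem integrable_inner (hμ : IsIsotropicMeasure μ) (θ : EuclideanSpace ℝ (Fin n)) :
    Integrable (fun x => inner ℝ x θ) μ :=
  hμ.integrable_id.inner_const θ

theorem integral_inner_eq_zero (hμ : IsIsotropicMeasure μ) (θ : EuclideanSpace ℝ (Fin n)) :
    ∫ x, inner ℝ x θ ∂μ = 0 := by
  simp_rw [real_inner_comm θ]
  rw [integral_inner hμ.integrable_id θ, hμ.barycenter_eq_zero, inner_zero_right]

end IsIsotropicMeasure

/-- The midpoint of a point outside the slab of half-width `3√v` and one inside the slab of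
half-width `√v` lies outside the latter. This is Borell's tail argument with squares. -/
theorem IsLogConcaveMeasure.measure_nine_mul_lt_le (hlc : IsLogConcaveMeasure μ)
    (θ : EuclideanSpace ℝ (Fin n)) {v : ℝ} (hv : 0 ≤ v) :
    μ {x | 9 * v < (inner ℝ x θ) ^ 2} * μ {x | (inner ℝ x θ) ^ 2 ≤ v} ≤
      μ {x | v < (inner ℝ x θ) ^ 2} ^ 2 := by
  have hm : Measurable fun x : EuclideanSpace ℝ (Fin n) => (inner ℝ x θ) ^ 2 := by fun_prop
  have h := hlc {x | 9 * v < (inner ℝ x θ) ^ 2} {x | (inner ℝ x θ) ^ 2 ≤ v}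
    (measurableSet_lt measurable_const hm) (measurableSet_le hm measurable_const) (1 / 2)
    (by norm_num) (by norm_num)
  have hsub : (1 / 2 : ℝ) • {x | 9 * v < (inner ℝ x θ) ^ 2} +
      (1 - 1 / 2 : ℝ) • {x | (inner ℝ x θ) ^ 2 ≤ v} ⊆ {x | v < (inner ℝ x θ) ^ 2} := by
    rintro _ ⟨_, ⟨b, hb, rfl⟩, _, ⟨a, ha, rfl⟩, rfl⟩
    simp only [Set.mem_ofPred_eq] at ha hb ⊢
    rw [inner_add_left, real_inner_smul_left, real_inner_smul_left]
    have h3 : 9 * v = (3 * √v) ^ 2 := by rw [mul_pow, Real.sq_sqrt hv]; norm_num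
    have ha' : |inner ℝ a θ| ≤ √v := Real.abs_le_sqrt ha
    have hb' : 3 * √v < |inner ℝ b θ| := by
      rw [h3] at hb
      exact lt_of_pow_lt_pow_left₀ 2 (abs_nonneg _) (by rwa [sq_abs])
    rw [← Real.sq_sqrt hv, sq_lt_sq, abs_of_nonneg (Real.sqrt_nonneg v)]
    have := abs_sub_abs_le_abs_sub (1 / 2 * inner ℝ b θ) (-((1 - 1 / 2) * inner ℝ a θ))
    rw [abs_neg, sub_neg_eq_add, abs_mul, abs_mul] at this
    norm_num at this ⊢
    linarith
  have h' := h.trans (measure_mono hsub)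
  have h2 := pow_le_pow_left₀ (zero_le) h' 2
  rw [mul_pow, ← ENNReal.rpow_natCast, ← ENNReal.rpow_natCast, ← ENNReal.rpow_mul,
    ← ENNReal.rpow_mul] at h2
  norm_num at h2
  exact h2

/-- Were this mass too small, Borell's tail inequality would make the tails decay so fast that the
second moment could not be one. -/
theorem IsIsotropicMeasure.le_measure_lt_inner_sq (hμ : IsIsotropicMeasure μ)
    (hlc : IsLogConcaveMeasure μ) {θ : EuclideanSpace ℝ (Fin n)} (hθ : ‖θ‖ = 1) :
    ENNReal.ofReal (1 / 24) < μ {x | 1 / 25 < (inner ℝ x θ) ^ 2} := by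
  have := hμ.isProbabilityMeasure
  by_contra! hle
  have hm : Measurable fun x : EuclideanSpace ℝ (Fin n) => (inner ℝ x θ) ^ 2 := by fun_prop
  have key : ∀ v : ℝ, 1 / 25 ≤ v → μ {x | 9 * v < (inner ℝ x θ) ^ 2} ≤
      ENNReal.ofReal (1 / 18) * μ {x | v < (inner ℝ x θ) ^ 2} := by
    intro v hv
    have h1 := hlc.measure_nine_mul_lt_le θ (v := v) (by linarith)
    have h2 : μ {x | v < (inner ℝ x θ) ^ 2} ≤ ENNReal.ofReal (1 / 24) :=
      (measure_mono fun x hx => lt_of_le_of_lt hv hx).trans hle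
    have h3 : ENNReal.ofReal (3 / 4) ≤ μ {x | (inner ℝ x θ) ^ 2 ≤ v} := by
      have hc : {x | (inner ℝ x θ) ^ 2 ≤ v} = {x | v < (inner ℝ x θ) ^ 2}ᶜ := by ext; simp
      rw [hc, measure_compl (measurableSet_lt measurable_const hm) (measure_ne_top _ _),
        measure_univ]
      refine le_trans ?_ (tsub_le_tsub_left h2 1)
      rw [← ENNReal.ofReal_one, ← ENNReal.ofReal_sub _ (by norm_num)]
      exact ENNReal.ofReal_le_ofReal (by norm_num)
    have h4 : μ {x | 9 * v < (inner ℝ x θ) ^ 2} * ENNReal.ofReal (3 / 4) ≤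
        ENNReal.ofReal (1 / 24) * μ {x | v < (inner ℝ x θ) ^ 2} := by
      refine le_trans (by gcongr) (h1.trans ?_)
      rw [sq]
      gcongr
    calc μ {x | 9 * v < (inner ℝ x θ) ^ 2}
        = μ {x | 9 * v < (inner ℝ x θ) ^ 2} * ENNReal.ofReal (3 / 4) * ENNReal.ofReal (4 / 3) := by
          rw [mul_assoc, ← ENNReal.ofReal_mul (by norm_num)]
          norm_num
      _ ≤ ENNReal.ofReal (1 / 24) * μ {x | v < (inner ℝ x θ) ^ 2} * ENNReal.ofReal (4 / 3) := by
          gcongr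
      _ = _ := by
          rw [mul_right_comm, ← ENNReal.ofReal_mul (by norm_num)]
          norm_num
  have e1 : ∫⁻ x, ENNReal.ofReal ((inner ℝ x θ) ^ 2 / 9) ∂μ = ENNReal.ofReal (1 / 9) := by
    have : ∀ x : EuclideanSpace ℝ (Fin n), ENNReal.ofReal ((inner ℝ x θ) ^ 2 / 9) =
        ENNReal.ofReal (1 / 9) * ENNReal.ofReal ((inner ℝ x θ) ^ 2) := fun x => by
      rw [← ENNReal.ofReal_mul (by norm_num)]
      congr 1
      ring
    simp_rw [this]
    rw [lintegral_const_mul' _ _ ENNReal.ofReal_ne_top, hμ.lintegral_inner_sq hθ, mul_one]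
  have e2 := hμ.lintegral_inner_sq hθ
  rw [lintegral_eq_lintegral_meas_lt μ (by filter_upwards with x using by positivity)
    (hm.div_const 9).aemeasurable] at e1
  rw [lintegral_eq_lintegral_meas_lt μ (by filter_upwards with x using by positivity)
    hm.aemeasurable] at e2
  have hpt : ∀ v ∈ Set.Ioi (0 : ℝ), μ {x | v < (inner ℝ x θ) ^ 2 / 9} ≤
      (Set.Ioc (0 : ℝ) (1 / 25)).indicator (fun _ => 1) v +
        ENNReal.ofReal (1 / 18) * μ {x | v < (inner ℝ x θ) ^ 2} := by
    intro v hv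
    rcases le_or_gt v (1 / 25) with h | h
    · rw [Set.indicator_of_mem (show v ∈ Set.Ioc (0 : ℝ) (1 / 25) from ⟨hv, h⟩)]
      exact prob_le_one.trans le_self_add
    · refine le_trans ?_ le_add_self
      refine le_trans (measure_mono fun x hx => ?_) (key v h.le)
      simp only [Set.mem_ofPred_eq] at hx ⊢
      -- The resulting integrated comparison will read `1/9 ≤ 1/25 + 1/18`, which is false.
      linarith
  have hfin := setLIntegral_mono' (μ := volume) measurableSet_Ioi hpt
  rw [lintegral_add_left (measurable_const.indicator measurableSet_Ioc),
    lintegral_const_mul' _ _ ENNReal.ofReal_ne_top, e1, e2,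
    lintegral_indicator measurableSet_Ioc, Measure.restrict_restrict measurableSet_Ioc,
    setLIntegral_const, one_mul, mul_one, Set.inter_eq_left.2 (fun x hx => hx.1),
    Real.volume_Ioc, ← ENNReal.ofReal_add (by norm_num) (by norm_num),
    ENNReal.ofReal_le_ofReal_iff (by norm_num)] at hfin
  norm_num at hfin

theorem IsIsotropicMeasure.le_integral_abs_inner (hμ : IsIsotropicMeasure μ)
    (hlc : IsLogConcaveMeasure μ) {θ : EuclideanSpace ℝ (Fin n)} (hθ : ‖θ‖ = 1) :
    1 / 120 ≤ ∫ x, |inner ℝ x θ| ∂μ := by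
  have := hμ.isProbabilityMeasure
  have h1 := mul_meas_ge_le_integral_of_nonneg (μ := μ) (f := fun x => |inner ℝ x θ|)
    (by filter_upwards with x using abs_nonneg _) (hμ.integrable_inner θ).abs (1 / 5)
  have h2 : (1 / 24 : ℝ) ≤ μ.real {x | 1 / 5 ≤ |inner ℝ x θ|} := by
    have h3 := (hμ.le_measure_lt_inner_sq hlc hθ).le.trans
      (measure_mono (t := {x | 1 / 5 ≤ |inner ℝ x θ|}) fun x hx => by
        simp only [Set.mem_ofPred_eq] at hx ⊢
        refine Real.le_sqrt_of_sq_le ?_ |>.trans_eq (Real.sqrt_sq_eq_abs _)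
        norm_num
        norm_num at hx
        exact hx.le)
    rwa [ENNReal.ofReal_le_iff_le_toReal (measure_ne_top _ _)] at h3
  linarith

/-- The barycentre is zero, so the positive part has half the first absolute moment. -/
theorem IsIsotropicMeasure.le_integral_inner_posPart (hμ : IsIsotropicMeasure μ)
    (hlc : IsLogConcaveMeasure μ) {θ : EuclideanSpace ℝ (Fin n)} (hθ : ‖θ‖ = 1) :
    1 / 240 ≤ ∫ x, max (inner ℝ x θ) 0 ∂μ := by
  have h1 : ∀ x : EuclideanSpace ℝ (Fin n),
      max (inner ℝ x θ) 0 = (|inner ℝ x θ| + inner ℝ x θ) / 2 := fun x => by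
    rcases le_total (inner ℝ x θ) 0 with h | h
    · rw [max_eq_right h, abs_of_nonpos h]; ring
    · rw [max_eq_left h, abs_of_nonneg h]; ring
  simp_rw [h1]
  rw [integral_div, integral_add (hμ.integrable_inner θ).abs (hμ.integrable_inner θ),
    hμ.integral_inner_eq_zero]
  linarith [hμ.le_integral_abs_inner hlc hθ]

theorem MeasureTheory.lt_measure_lt_of_le_integral {α : Type*} [MeasurableSpace α] {ν : Measure α}
    [IsProbabilityMeasure ν] {Y : α → ℝ} (hYm : Measurable Y) (hYi : Integrable Y ν)
    (hY2i : Integrable (fun x => Y x ^ 2) ν) (hY1 : 1 / 240 ≤ ∫ x, Y x ∂ν)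
    (hY2 : ∫ x, Y x ^ 2 ∂ν ≤ 1) :
    ENNReal.ofReal (1 / 1000000) < ν {x | 1 / 960 < Y x} := by
  have hms : MeasurableSet {x | 1 / 960 < Y x} := measurableSet_lt measurable_const hYm
  -- A Paley–Zygmund argument: integrating gives `4/960 ≤ 1/960 + 960 p + 1/960`, so `p ≥ 2/960² >
  -- 10⁻⁶`.
  have hpt : ∀ x, Y x ≤ 1 / 960 + {x | 1 / 960 < Y x}.indicator (fun _ => (960 : ℝ)) x +
      Y x ^ 2 / 960 := by
    intro x
    by_cases h : 1 / 960 < Y x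
    · rw [Set.indicator_of_mem (show x ∈ {x | 1 / 960 < Y x} from h)]
      nlinarith [sq_nonneg (Y x - 960)]
    · rw [Set.indicator_of_notMem (show x ∉ {x | 1 / 960 < Y x} from h)]
      nlinarith [sq_nonneg (Y x)]
  have hi : Integrable ({x | 1 / 960 < Y x}.indicator (fun _ => (960 : ℝ))) ν :=
    (integrable_const _).indicator hms
  have hi' : Integrable (fun x => 1 / 960 + {x | 1 / 960 < Y x}.indicator
      (fun _ => (960 : ℝ)) x) ν := (integrable_const (1 / 960 : ℝ)).add hi
  have h1 := integral_mono hYi (hi'.add (hY2i.div_const 960)) hpt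
  simp only [Pi.add_apply] at h1
  rw [integral_add hi' (hY2i.div_const 960)] at h1
  rw [integral_add (integrable_const _) hi, integral_const, integral_div,
    integral_indicator hms, setIntegral_const] at h1
  simp only [smul_eq_mul, probReal_univ, one_mul] at h1
  rw [ENNReal.ofReal_lt_iff_lt_toReal (by norm_num) (measure_ne_top _ _)]
  change _ < ν.real _
  linarith

theorem IsIsotropicMeasure.lt_measure_lt_inner (hμ : IsIsotropicMeasure μ)
    (hlc : IsLogConcaveMeasure μ) {θ : EuclideanSpace ℝ (Fin n)} (hθ : ‖θ‖ = 1) :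
    ENNReal.ofReal (1 / 1000000) < μ {x | 1 / 960 < inner ℝ x θ} := by
  have := hμ.isProbabilityMeasure
  have hm : Measurable fun x : EuclideanSpace ℝ (Fin n) => max (inner ℝ x θ) 0 := by fun_prop
  have hle : ∀ x : EuclideanSpace ℝ (Fin n), max (inner ℝ x θ) 0 ^ 2 ≤ (inner ℝ x θ) ^ 2 := by
    intro x
    rw [sq_le_sq, abs_of_nonneg (le_max_right _ _)]
    exact max_le (le_abs_self _) (abs_nonneg _)
  have h2i : Integrable (fun x => max (inner ℝ x θ) 0 ^ 2) μ :=
    (hμ.integrable_inner_sq hθ).mono' (hm.pow_const 2).aestronglyMeasurable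
      (by filter_upwards with x; rw [Real.norm_of_nonneg (sq_nonneg _)]; exact hle x)
  refine (lt_measure_lt_of_le_integral (ν := μ) hm (hμ.integrable_inner θ).pos_part h2i
    (hμ.le_integral_inner_posPart hlc hθ) ?_).trans_le (measure_mono fun x hx => ?_)
  · rw [← hμ.second_moment θ hθ]
    exact integral_mono h2i (hμ.integrable_inner_sq hθ) hle
  · simp only [Set.mem_ofPred_eq, lt_max_iff] at hx ⊢
    exact hx.resolve_right (by norm_num)

theorem IsIsotropicMeasure.lt_measure_lt_sum_abs (hn : 1 ≤ n) (hμ : IsIsotropicMeasure μ)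
    (hlc : IsLogConcaveMeasure μ) :
    ENNReal.ofReal (1 / 1000000) < μ {x | 1 / 960 < (∑ i, |x i|) / n} := by
  have := hμ.isProbabilityMeasure
  have hn0 : (0 : ℝ) < n := by exact_mod_cast hn
  have hm : Measurable fun x : EuclideanSpace ℝ (Fin n) => (∑ i, |x i|) / n := by fun_prop
  have hle : ∀ x : EuclideanSpace ℝ (Fin n), ((∑ i, |x i|) / n) ^ 2 ≤ (∑ i, x i ^ 2) / n := by
    intro x
    have := sq_sum_le_card_mul_sum_sq (s := Finset.univ) (f := fun i => |x i|)
    simp only [sq_abs, Finset.card_univ, Fintype.card_fin] at this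
    rw [div_pow, div_le_div_iff₀ (by positivity) hn0]
    nlinarith
  have hs (i : Fin n) : ‖EuclideanSpace.single i (1 : ℝ)‖ = 1 := by simp
  have hi1 (i : Fin n) : Integrable (fun x : EuclideanSpace ℝ (Fin n) => |x i|) μ := by
    have := (hμ.integrable_inner (EuclideanSpace.single i (1 : ℝ))).abs
    simpa only [inner_single] using this
  have hi2 : Integrable (fun x : EuclideanSpace ℝ (Fin n) => (∑ i, x i ^ 2) / n) μ :=
    (integrable_finsetSum _ fun i _ => hμ.integrable_apply_sq i).div_const _
  have h2i : Integrable (fun x : EuclideanSpace ℝ (Fin n) => ((∑ i, |x i|) / n) ^ 2) μ :=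
    hi2.mono' (hm.pow_const 2).aestronglyMeasurable
      (by filter_upwards with x; rw [Real.norm_of_nonneg (sq_nonneg _)]; exact hle x)
  refine lt_measure_lt_of_le_integral (ν := μ) hm
    ((integrable_finsetSum _ fun i _ => hi1 i).div_const _) h2i ?_ ?_
  · rw [integral_div, integral_finsetSum _ fun i _ => hi1 i, le_div_iff₀ hn0]
    have : ∀ i ∈ (Finset.univ : Finset (Fin n)), (1 / 120 : ℝ) ≤ ∫ x, |x i| ∂μ := fun i _ => by
      have := hμ.le_integral_abs_inner hlc (hs i)
      simpa only [inner_single] using this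
    have := Finset.card_nsmul_le_sum _ _ _ this
    simp only [Finset.card_univ, Fintype.card_fin, nsmul_eq_mul] at this
    linarith
  · refine (integral_mono h2i hi2 hle).trans (le_of_eq ?_)
    rw [integral_div, integral_finsetSum _ fun i _ => hμ.integrable_apply_sq i]
    have : ∀ i : Fin n, ∫ x : EuclideanSpace ℝ (Fin n), x i ^ 2 ∂μ = 1 := fun i => by
      have := hμ.second_moment _ (hs i)
      simpa only [inner_single] using this
    simp [this, hn0.ne']

/-- A point of the ball outside `closure D` is separated from it by a hyperplane, and `Dᶜ` then
contains a half-space `⟨x, θ⟩ > 1/960`, whose mass is too large. -/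
theorem IsIsotropicMeasure.ball_subset_interior (hμ : IsIsotropicMeasure μ)
    (hlc : IsLogConcaveMeasure μ) (hac : μ ≪ volume) {D : Set (EuclideanSpace ℝ (Fin n))}
    (hD : Convex ℝ D) (hμD : μ Dᶜ ≤ ENNReal.ofReal (1 / 1000000)) :
    Metric.ball 0 (1 / 960) ⊆ interior D := by
  have := hμ.isProbabilityMeasure
  have hD0 : volume D ≠ 0 := fun h => by
    have h1 : (1 : ℝ≥0∞) ≤ μ D + μ Dᶜ := by
      rw [← measure_univ (μ := μ), ← Set.union_compl_self D]
      exact measure_union_le _ _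
    rw [hac h, zero_add] at h1
    have := h1.trans hμD
    rw [ENNReal.one_le_ofReal] at this
    norm_num at this
  rw [← hD.interior_closure_eq_interior_of_nonempty_interior
    (hD.interior_nonempty_of_addHaar_ne_zero hD0)]
  refine interior_maximal (fun x hx => ?_) Metric.isOpen_ball
  rw [mem_ball_zero_iff] at hx
  by_contra hxD
  obtain ⟨g, u, hgx, hg⟩ := geometric_hahn_banach_point_closed hD.closure isClosed_closure hxD
  set v := (InnerProductSpace.toDual ℝ (EuclideanSpace ℝ (Fin n))).symm g with hv
  have hgv : ∀ z, g z = inner ℝ z v := fun z => by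
    rw [real_inner_comm, hv, InnerProductSpace.toDual_symm_apply]
  have hv0 : v ≠ 0 := by
    rintro h0
    obtain ⟨z, hz⟩ : D.Nonempty := nonempty_of_measure_ne_zero hD0
    have := hg z (subset_closure hz)
    rw [hgv, h0, inner_zero_right] at this hgx
    linarith
  have hvn : 0 < ‖v‖ := norm_pos_iff.2 hv0
  refine absurd (hμ.lt_measure_lt_inner hlc (θ := -(‖v‖⁻¹ • v)) ?_)
    (not_lt.2 (le_trans (measure_mono (t := Dᶜ) fun z hz hzD => ?_) hμD))
  · rw [norm_neg, norm_smul, norm_inv, norm_norm, inv_mul_cancel₀ hvn.ne']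
  · have h1 := hg z (subset_closure hzD)
    rw [hgv] at h1 hgx
    simp only [Set.mem_ofPred_eq] at hz
    rw [inner_neg_right, real_inner_smul_right, ← mul_neg, lt_inv_mul_iff₀ hvn] at hz
    have h2 := abs_real_inner_le_norm x v
    have h3 : ‖x‖ * ‖v‖ < 1 / 960 * ‖v‖ := by gcongr
    have := neg_abs_le (inner ℝ x v)
    linarith

end Moments

/-! ### Existence of a log-concave density. -/

section Borell

variable {n : ℕ} {μ : Measure (EuclideanSpace ℝ (Fin n))}

/-- The lower density of `μ` with respect to Lebesgue measure. -/
noncomputable def lowerDensity (μ : Measure (EuclideanSpace ℝ (Fin n)))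
    (x : EuclideanSpace ℝ (Fin n)) : ℝ≥0∞ :=
  liminf (fun r : ℝ => μ (Metric.closedBall x r) / volume (Metric.closedBall x r)) (𝓝[>] 0)

/-- Balls of equal radius combine into a ball of the same radius, and all have the same volume. A
lower limit is used because it is supermultiplicative, which is the direction needed, and exists at
every point. -/
theorem IsLogConcaveMeasure.lowerDensity_rpow_mul_le (hlc : IsLogConcaveMeasure μ)
    (x y : EuclideanSpace ℝ (Fin n)) {l : ℝ} (h0 : 0 < l) (h1 : l < 1) :
    lowerDensity μ x ^ l * lowerDensity μ y ^ (1 - l) ≤ lowerDensity μ (l • x + (1 - l) • y) := by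
  have hpow : ∀ (z : EuclideanSpace ℝ (Fin n)) {p : ℝ}, 0 < p → lowerDensity μ z ^ p =
      liminf (fun r : ℝ => (μ (Metric.closedBall z r) / volume (Metric.closedBall z r)) ^ p)
        (𝓝[>] 0) := fun z p hp =>
    (ENNReal.monotone_rpow_of_nonneg hp.le).map_liminf_of_continuousAt _
      ENNReal.continuous_rpow_const.continuousAt
  rw [hpow x h0, hpow y (sub_pos.2 h1)]
  refine ENNReal.le_liminf_mul.trans (liminf_le_liminf ?_)
  filter_upwards [self_mem_nhdsWithin] with r hr
  have hr : 0 < r := hr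
  simp only [Pi.mul_apply]
  have hvol : ∀ z : EuclideanSpace ℝ (Fin n), volume (Metric.closedBall z r) =
      volume (Metric.closedBall (0 : EuclideanSpace ℝ (Fin n)) r) := fun z =>
    Measure.addHaar_closedBall_center _ z r
  set v := volume (Metric.closedBall (0 : EuclideanSpace ℝ (Fin n)) r) with hv
  have hv0 : v ≠ 0 := (Metric.measure_closedBall_pos volume _ hr).ne'
  have hvt : v ≠ ∞ := measure_closedBall_lt_top.ne
  rw [hvol x, hvol y, hvol (l • x + (1 - l) • y), ENNReal.div_rpow_of_nonneg _ _ h0.le,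
    ENNReal.div_rpow_of_nonneg _ _ (sub_pos.2 h1).le]
  have hvv : v ^ l * v ^ (1 - l) = v := by
    rw [← ENNReal.rpow_add _ _ hv0 hvt, add_sub_cancel, ENNReal.rpow_one]
  have hsub : l • Metric.closedBall x r + (1 - l) • Metric.closedBall y r ⊆
      Metric.closedBall (l • x + (1 - l) • y) r := by
    rintro _ ⟨_, ⟨a, ha, rfl⟩, _, ⟨b, hb, rfl⟩, rfl⟩
    rw [mem_closedBall_iff_norm] at *
    have e : l • a + (1 - l) • b - (l • x + (1 - l) • y) = l • (a - x) + (1 - l) • (b - y) := by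
      module
    simp only
    rw [e]
    refine (norm_add_le _ _).trans ?_
    rw [norm_smul, norm_smul, Real.norm_of_nonneg h0.le, Real.norm_of_nonneg (sub_pos.2 h1).le]
    nlinarith
  have h := (hlc _ _ (measurableSet_closedBall (x := x) (ε := r))
    (measurableSet_closedBall (x := y) (ε := r)) l h0 h1).trans (measure_mono hsub)
  rw [ENNReal.div_eq_inv_mul, ENNReal.div_eq_inv_mul, ENNReal.div_eq_inv_mul, mul_mul_mul_comm,
    ← ENNReal.mul_inv (Or.inr (by simp [ENNReal.rpow_eq_top_iff, hvt, hv0]))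
      (Or.inl (by simp [ENNReal.rpow_eq_top_iff, hvt, hv0])), hvv]
  gcongr

theorem lowerDensity_ae_eq_rnDeriv [IsFiniteMeasure μ] :
    ∀ᵐ x, lowerDensity μ x = μ.rnDeriv volume x := by
  filter_upwards [Besicovitch.ae_tendsto_rnDeriv μ volume] with x hx
  exact hx.liminf_eq

/-- Differentiating Lebesgue measure with respect to the singular part gives zero; the inverse
ratios tend to infinity. -/
theorem lowerDensity_eq_top_ae_singularPart [IsFiniteMeasure μ] :
    ∀ᵐ x ∂(μ.singularPart volume), lowerDensity μ x = ∞ := by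
  set ν := μ.singularPart (volume : Measure (EuclideanSpace ℝ (Fin n))) with hν
  have hsing : (volume : Measure (EuclideanSpace ℝ (Fin n))) ⟂ₘ ν :=
    (Measure.mutuallySingular_singularPart μ volume).symm
  filter_upwards [Besicovitch.ae_tendsto_rnDeriv volume ν, hsing.rnDeriv_ae_eq_zero] with x h1 h2
  rw [h2, Pi.zero_apply] at h1
  have h3 := tendsto_inv_iff.2 h1
  rw [ENNReal.inv_zero] at h3
  rw [← top_le_iff, ← h3.liminf_eq]
  refine liminf_le_liminf ?_
  filter_upwards [self_mem_nhdsWithin] with r hr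
  have hr : 0 < r := hr
  have hv0 : volume (Metric.closedBall x r) ≠ 0 := (Metric.measure_closedBall_pos volume _ hr).ne'
  have hvt : volume (Metric.closedBall x r) ≠ ∞ := measure_closedBall_lt_top.ne
  rw [ENNReal.inv_div (Or.inr hvt) (Or.inr hv0)]
  gcongr
  exact Measure.singularPart_le μ volume

/-- The midpoint between `x₀` and any point of positive lower density again has infinite lower
density, and such points form a null set. -/
theorem IsLogConcaveMeasure.lowerDensity_ae_eq_zero [IsFiniteMeasure μ]
    (hlc : IsLogConcaveMeasure μ) {x₀ : EuclideanSpace ℝ (Fin n)} (hx₀ : lowerDensity μ x₀ = ∞) :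
    ∀ᵐ x, lowerDensity μ x = 0 := by
  have h1 : ∀ᵐ x, lowerDensity μ x ≠ ∞ := by
    filter_upwards [lowerDensity_ae_eq_rnDeriv (μ := μ), Measure.rnDeriv_lt_top μ volume]
      with x hx hx'
    rw [hx]
    exact hx'.ne
  have h2 : AffineMap.homothety x₀ (1 / 2 : ℝ) '' {x | ¬ lowerDensity μ x = 0} ⊆
      {x | ¬ lowerDensity μ x ≠ ∞} := by
    rintro _ ⟨x, hx, rfl⟩
    have h := hlc.lowerDensity_rpow_mul_le x₀ x (l := 1 / 2) (by norm_num) (by norm_num)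
    have e : AffineMap.homothety x₀ (1 / 2 : ℝ) x = (1 / 2 : ℝ) • x₀ + (1 - 1 / 2 : ℝ) • x := by
      rw [AffineMap.homothety_apply, vsub_eq_sub, vadd_eq_add]
      module
    rw [hx₀, ENNReal.top_rpow_of_pos (by norm_num), ENNReal.top_mul, top_le_iff] at h
    · simp only [Set.mem_ofPred_eq, not_not, e]
      exact h
    · intro h0
      rw [ENNReal.rpow_eq_zero_iff] at h0
      rcases h0 with h0 | h0
      · exact hx h0.1
      · norm_num at h0
  have h3 := measure_mono_null h2 h1
  rw [Measure.addHaar_image_homothety] at h3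
  exact (mul_eq_zero.1 h3).resolve_left (by simp)

/-- A null convex set lies in a hyperplane. The marginal along its normal is constant, hence zero by
centring, contradicting unit variance. -/
theorem IsIsotropicMeasure.not_ae_mem_of_convex_null (hμ : IsIsotropicMeasure μ)
    {Z : Set (EuclideanSpace ℝ (Fin n))} (hZ : Convex ℝ Z) (hvol : volume Z = 0)
    (hae : ∀ᵐ x ∂μ, x ∈ Z) : False := by
  have := hμ.isProbabilityMeasure
  obtain ⟨z₀, hz₀⟩ : Z.Nonempty := hae.exists
  have hint : ¬ (interior Z).Nonempty := fun h =>
    (Measure.measure_pos_of_nonempty_interior volume h).ne' hvol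
  rw [hZ.interior_nonempty_iff_affineSpan_eq_top] at hint
  have hdir : (affineSpan ℝ Z).direction ≠ ⊤ := fun h =>
    hint ((AffineSubspace.direction_eq_top_iff_of_nonempty
      ⟨z₀, subset_affineSpan ℝ Z hz₀⟩).1 h)
  obtain ⟨v, hv, hv0⟩ := Submodule.exists_mem_ne_zero_of_ne_bot
    (fun h => hdir ((Submodule.orthogonal_eq_bot_iff).1 h))
  have hvn : 0 < ‖v‖ := norm_pos_iff.2 hv0
  set θ := ‖v‖⁻¹ • v with hθ
  have hθ1 : ‖θ‖ = 1 := by rw [hθ, norm_smul, norm_inv, norm_norm, inv_mul_cancel₀ hvn.ne']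
  have hconst : ∀ᵐ x ∂μ, inner ℝ x θ = inner ℝ z₀ θ := by
    filter_upwards [hae] with x hx
    have h1 : x - z₀ ∈ (affineSpan ℝ Z).direction :=
      AffineSubspace.vsub_mem_direction (subset_affineSpan ℝ Z hx) (subset_affineSpan ℝ Z hz₀)
    have h2 := (Submodule.mem_orthogonal _ _).1 hv _ h1
    rw [hθ, real_inner_smul_right, real_inner_smul_right, ← sub_eq_zero, ← mul_sub,
      ← inner_sub_left, h2, mul_zero]
  have h0 : inner ℝ z₀ θ = (0 : ℝ) := by
    have := hμ.integral_inner_eq_zero θ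
    rw [integral_congr_ae hconst] at this
    simpa using this
  have h1 := hμ.second_moment θ hθ1
  rw [integral_congr_ae (g := fun _ => 0) (by
    filter_upwards [hconst] with x hx
    rw [hx, h0]
    norm_num)] at h1
  simp at h1

/-- Borell's theorem for isotropic measures. -/
theorem IsIsotropicMeasure.exists_isLogConcaveDensity (hμ : IsIsotropicMeasure μ)
    (hlc : IsLogConcaveMeasure μ) : ∃ f, IsLogConcaveDensity f μ := by
  have := hμ.isProbabilityMeasure
  have hdec := Measure.haveLebesgueDecomposition_add μ
    (volume : Measure (EuclideanSpace ℝ (Fin n)))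
  have hzero : (∀ᵐ x, lowerDensity μ x = 0) → μ = μ.singularPart volume := fun h => by
    have h1 : volume.withDensity (μ.rnDeriv volume) = 0 := by
      rw [withDensity_eq_zero_iff (Measure.measurable_rnDeriv _ _).aemeasurable]
      filter_upwards [h, lowerDensity_ae_eq_rnDeriv (μ := μ)] with x h1 h2
      rw [← h2, h1, Pi.zero_apply]
    conv_lhs => rw [hdec, h1, add_zero]
  have hs : μ.singularPart volume = 0 := by
    by_contra hne
    obtain ⟨x₀, hx₀⟩ : ∃ x₀, lowerDensity μ x₀ = ∞ := by
      have : (ae (μ.singularPart volume)).NeBot := ae_neBot.2 hne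
      exact (lowerDensity_eq_top_ae_singularPart (μ := μ)).exists
    have h0 := hlc.lowerDensity_ae_eq_zero hx₀
    have hae := lowerDensity_eq_top_ae_singularPart (μ := μ)
    rw [← hzero h0] at hae
    -- A nonzero singular part would make `μ` wholly singular and carried by this set, which is
    -- convex and null.
    refine hμ.not_ae_mem_of_convex_null (Z := {x | lowerDensity μ x = ∞}) ?_ ?_ hae
    · intro x hx y hy a b ha hb hab
      rcases ha.eq_or_lt with rfl | ha
      · obtain rfl : b = 1 := by linarith
        simpa using hy
      rcases hb.eq_or_lt with rfl | hb
      · obtain rfl : a = 1 := by linarith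
        simpa using hx
      obtain rfl : b = 1 - a := by linarith
      have h := hlc.lowerDensity_rpow_mul_le x y ha (by linarith)
      simp only [Set.mem_ofPred_eq] at hx hy ⊢
      rw [hx, hy, ENNReal.top_rpow_of_pos ha, ENNReal.top_rpow_of_pos hb, ENNReal.top_mul_top,
        top_le_iff] at h
      exact h
    · refine measure_mono_null (fun x hx => ?_) h0
      simp only [Set.mem_ofPred_eq] at hx
      simp [hx]
  have htop : ∀ x, lowerDensity μ x ≠ ∞ := fun x hx => by
    have h := hzero (hlc.lowerDensity_ae_eq_zero hx)
    rw [hs] at h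
    exact IsProbabilityMeasure.ne_zero μ h
  refine ⟨fun x => (lowerDensity μ x).toReal, fun x => ENNReal.toReal_nonneg, fun x y l h0 h1 => ?_,
    ?_⟩
  · rcases h0.eq_or_lt with rfl | h0
    · simp
    rcases h1.eq_or_lt with rfl | h1
    · simp
    rw [ENNReal.toReal_rpow, ENNReal.toReal_rpow, ← ENNReal.toReal_mul]
    exact ENNReal.toReal_mono (htop _) (hlc.lowerDensity_rpow_mul_le x y h0 h1)
  · conv_lhs => rw [hdec, hs, zero_add]
    refine withDensity_congr_ae ?_
    filter_upwards [lowerDensity_ae_eq_rnDeriv (μ := μ)] with x hx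
    rw [ENNReal.ofReal_toReal (htop x), hx]

end Borell

/-! ### Signed permutations and cubes. -/

section Symmetry

variable {n : ℕ} {f : EuclideanSpace ℝ (Fin n) → ℝ} {μ : Measure (EuclideanSpace ℝ (Fin n))}

/-- A signed permutation of the coordinates. -/
noncomputable def signedPerm (σ : Equiv.Perm (Fin n)) (s : Fin n → ℤˣ) :
    EuclideanSpace ℝ (Fin n) ≃ₗᵢ[ℝ] EuclideanSpace ℝ (Fin n) :=
  LinearIsometry.toLinearIsometryEquiv
    { toFun := fun x => WithLp.toLp 2 (fun i => ((s i : ℤ) : ℝ) * x (σ i))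
      map_add' := fun x y => by ext i; simp [mul_add]
      map_smul' := fun c x => by ext i; simp; ring
      norm_map' := fun x => by
        have h : ∀ i, (((s i : ℤ) : ℝ) * x (σ i)) ^ 2 = x (σ i) ^ 2 := fun i => by
          rcases Int.units_eq_one_or (s i) with h | h <;> simp [h]
        rw [← sq_eq_sq₀ (norm_nonneg _) (norm_nonneg _), EuclideanSpace.real_norm_sq_eq,
          EuclideanSpace.real_norm_sq_eq]
        simp only [LinearMap.coe_mk, AddHom.coe_mk, h]
        exact Equiv.sum_comp σ (fun i => x i ^ 2) } rfl

theorem coe_signedPerm (σ : Equiv.Perm (Fin n)) (s : Fin n → ℤˣ) :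
    ⇑(signedPerm σ s) = fun x : EuclideanSpace ℝ (Fin n) =>
      WithLp.toLp 2 (fun i => ((s i : ℤ) : ℝ) * x (σ i)) := rfl

theorem IsLogConcaveDensity.comp_linearIsometryEquiv (hf : IsLogConcaveDensity f μ)
    {T : EuclideanSpace ℝ (Fin n) ≃ₗᵢ[ℝ] EuclideanSpace ℝ (Fin n)} (hT : μ.map T = μ) :
    IsLogConcaveDensity (f ∘ T) μ where
  nonneg x := hf.nonneg _
  logConcave x y l h0 h1 := by
    simpa using hf.logConcave (T x) (T y) l h0 h1
  eq_withDensity := by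
    have hTe : MeasurableEmbedding T := T.toHomeomorph.measurableEmbedding
    ext S hS
    rw [withDensity_apply _ hS]
    have h1 := T.measurePreserving.setLIntegral_comp_emb hTe (fun y => ENNReal.ofReal (f y)) S
    have h2 : μ S = μ (T '' S) := by
      conv_rhs => rw [← hT]
      rw [hTe.map_apply, Set.preimage_image_eq _ T.injective]
    rw [h2, hf.apply_eq]
    exact h1.symm

/-- The density is symmetric only almost everywhere, so its level sets may break the symmetry on
null sets; their interiors cannot. -/
theorem IsOneSymmetric.signedPerm_mem_interior_levelSet [IsProbabilityMeasure μ]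
    (hs : IsOneSymmetric μ) (hf : IsLogConcaveDensity f μ) {t : ℝ} (ht : 0 < t)
    (σ : Equiv.Perm (Fin n)) (s : Fin n → ℤˣ) {x : EuclideanSpace ℝ (Fin n)}
    (hx : x ∈ interior (levelSet f t)) : signedPerm σ s x ∈ interior (levelSet f t) := by
  have hfT := hf.comp_linearIsometryEquiv (T := signedPerm σ s) (hs σ s)
  have hpre : levelSet (f ∘ signedPerm σ s) t = signedPerm σ s ⁻¹' levelSet f t := rfl
  have hsub : interior (levelSet f t) ⊆ interior (levelSet (f ∘ signedPerm σ s) t) := by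
    refine (hfT.convex_levelSet ht).interior_subset_interior_of_volume_diff ?_
    refine measure_mono_null (fun y hy => ?_) (hf.ae_eq hfT)
    rintro h
    simp only [Set.mem_ofPred_eq] at h
    exact hy.2 (le_of_le_of_eq hy.1 h)
  have hxi := hsub hx
  rw [hpre] at hxi
  have := (signedPerm σ s).toHomeomorph.preimage_interior (levelSet f t)
  change _ ∈ (signedPerm σ s).toHomeomorph ⁻¹' interior (levelSet f t)
  rw [this]
  exact hxi

/-- The cube `[-a, a]^n`. -/
def euclideanCube (n : ℕ) (a : ℝ) : Set (EuclideanSpace ℝ (Fin n)) := {x | ∀ i, |x i| ≤ a}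

theorem euclideanCube_eq_preimage (n : ℕ) (a : ℝ) :
    euclideanCube n a = (MeasurableEquiv.toLp 2 (Fin n → ℝ)).symm ⁻¹'
      (Set.univ.pi fun _ => Set.Icc (-a) a) := by
  ext x
  simp [euclideanCube, abs_le, Pi.le_def, forall_and]

theorem measurableSet_euclideanCube (n : ℕ) (a : ℝ) : MeasurableSet (euclideanCube n a) := by
  rw [euclideanCube_eq_preimage]
  exact (MeasurableEquiv.measurable _) (MeasurableSet.univ_pi fun _ => measurableSet_Icc)

theorem volume_euclideanCube (n : ℕ) (a : ℝ) :
    volume (euclideanCube n a) = ENNReal.ofReal (2 * a) ^ n := by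
  rw [euclideanCube_eq_preimage,
    (EuclideanSpace.volume_preserving_symm_measurableEquiv_toLp (Fin n)).measure_preimage
      (MeasurableSet.univ_pi fun _ => measurableSet_Icc).nullMeasurableSet, volume_pi_pi]
  simp [two_mul]

theorem convex_euclideanCube (n : ℕ) (a : ℝ) : Convex ℝ (euclideanCube n a) := by
  intro x hx y hy b c hb hc hbc i
  have h1 := abs_le.1 (hx i)
  have h2 := abs_le.1 (hy i)
  simp only [PiLp.add_apply, PiLp.smul_apply, smul_eq_mul, abs_le]
  constructor
  · calc -a = b * (-a) + c * (-a) := by rw [← add_mul, hbc, one_mul]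
      _ ≤ b * x i + c * y i := by gcongr; exacts [h1.1, h2.1]
  · calc b * x i + c * y i ≤ b * a + c * a := by gcongr; exacts [h1.2, h2.2]
      _ = a := by rw [← add_mul, hbc, one_mul]

theorem closedBall_subset_euclideanCube (n : ℕ) (a : ℝ) :
    Metric.closedBall 0 a ⊆ euclideanCube n a := fun x hx i => by
  rw [mem_closedBall_zero_iff] at hx
  exact (PiLp.norm_apply_le x i).trans hx

/-- This cross-polytope has volume `(2na)^n/n!`, and `n^n/n! ≤ e^n`. -/
theorem volume_sum_abs_div_le (hn : 1 ≤ n) {a : ℝ} (ha : 0 ≤ a) :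
    volume {x : EuclideanSpace ℝ (Fin n) | (∑ i, |x i|) / n ≤ a} ≤
      ENNReal.ofReal ((2 * Real.exp 1 * a) ^ n) := by
  have hn0 : (0 : ℝ) < n := by exact_mod_cast hn
  have : NeZero n := ⟨by omega⟩
  have h1 : {x : EuclideanSpace ℝ (Fin n) | (∑ i, |x i|) / n ≤ a} =
      (MeasurableEquiv.toLp 2 (Fin n → ℝ)).symm ⁻¹'
        {x : Fin n → ℝ | (∑ i, |x i| ^ (1 : ℝ)) ^ (1 / (1 : ℝ)) ≤ n * a} := by
    ext x
    simp [div_le_iff₀' hn0]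
  have hm : MeasurableSet {x : Fin n → ℝ | (∑ i, |x i| ^ (1 : ℝ)) ^ (1 / (1 : ℝ)) ≤ n * a} :=
    measurableSet_le (by fun_prop) measurable_const
  rw [h1, (EuclideanSpace.volume_preserving_symm_measurableEquiv_toLp (Fin n)).measure_preimage
    hm.nullMeasurableSet, volume_sum_rpow_le _ le_rfl, Fintype.card_fin,
    ← ENNReal.ofReal_pow (by positivity), ← ENNReal.ofReal_mul (by positivity)]
  refine ENNReal.ofReal_le_ofReal ?_
  have hG : Real.Gamma (1 / 1 + 1) = 1 := by norm_num
  rw [hG, div_one, Real.Gamma_nat_eq_factorial, mul_one]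
  have := Real.pow_div_factorial_le_exp (x := n) hn0.le n
  calc ((n : ℝ) * a) ^ n * (2 ^ n / n.factorial)
      = (n : ℝ) ^ n / n.factorial * (2 * a) ^ n := by rw [mul_pow, mul_pow]; ring
    _ ≤ Real.exp n * (2 * a) ^ n := by gcongr
    _ = _ := by
      rw [show (n : ℝ) = n * 1 by ring, Real.exp_nat_mul, ← mul_pow]
      congr 1
      ring

/-- Making the coordinates of `x` nonnegative and averaging over cyclic shifts puts `(m, …, m)` in
`D`, where `m` is the mean absolute coordinate. Sign changes give the vertices of a cube and
convexity gives the rest. -/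
theorem Convex.euclideanCube_subset_of_signedPerm (hn : 1 ≤ n)
    {D : Set (EuclideanSpace ℝ (Fin n))} (hD : Convex ℝ D)
    (hsym : ∀ σ s, ∀ x ∈ D, signedPerm σ s x ∈ D) {x : EuclideanSpace ℝ (Fin n)} (hx : x ∈ D)
    {a : ℝ} (ha : a ≤ (∑ i, |x i|) / n) : euclideanCube n a ⊆ D := by
  have hn0 : (0 : ℝ) < n := by exact_mod_cast hn
  have : NeZero n := ⟨by omega⟩
  set m := (∑ i, |x i|) / n with hm
  have hm0 : 0 ≤ m := by positivity
  set w : EuclideanSpace ℝ (Fin n) := WithLp.toLp 2 fun i => |x i| with hw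
  have hwD : w ∈ D := by
    have := hsym 1 (fun i => if 0 ≤ x i then 1 else -1) x hx
    convert this using 1
    ext i
    rw [coe_signedPerm]
    simp only [hw, Equiv.Perm.coe_one, id_eq]
    split_ifs with h
    · simp [abs_of_nonneg h]
    · simp [abs_of_neg (not_le.1 h)]
  have hmD : (WithLp.toLp 2 fun _ => m : EuclideanSpace ℝ (Fin n)) ∈ D := by
    have := hD.sum_mem (t := Finset.univ) (w := fun _ : Fin n => (n : ℝ)⁻¹)
      (z := fun j => signedPerm (Equiv.addRight j) 1 w) (fun i _ => by positivity)
      (by simp [hn0.ne']) (fun j _ => hsym _ _ w hwD)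
    convert this using 1
    ext i
    rw [← Finset.smul_sum, PiLp.smul_apply, WithLp.ofLp_sum, Finset.sum_apply]
    simp only [coe_signedPerm, hw, Pi.one_apply, Units.val_one, Int.cast_one, one_mul,
      Equiv.coe_addRight, smul_eq_mul]
    rw [hm, div_eq_inv_mul]
    congr 1
    exact (Equiv.sum_comp (Equiv.addLeft i) fun j => |x j|).symm
  have hvD : ∀ y ∈ Set.univ.pi (fun _ : Fin n => ({-m, m} : Set ℝ)),
      (WithLp.toLp 2 y : EuclideanSpace ℝ (Fin n)) ∈ D := by
    intro y hy
    have := hsym 1 (fun i => if y i = m then 1 else -1) _ hmD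
    convert this using 1
    ext i
    simp only [coe_signedPerm]
    rcases hy i (Set.mem_univ i) with h | h
    · by_cases h' : y i = m
      · simp [h']
      · rw [if_neg h']; simp [h]
    · have h' : y i = m := h
      simp [h']
  have hconv : Convex ℝ {y : Fin n → ℝ | (WithLp.toLp 2 y : EuclideanSpace ℝ (Fin n)) ∈ D} :=
    hD.linear_preimage (WithLp.linearEquiv 2 ℝ (Fin n → ℝ)).symm.toLinearMap
  have hhull := convexHull_min hvD hconv
  rw [convexHull_pi] at hhull
  intro z hz
  refine hhull (a := z.ofLp) fun i _ => ?_
  rw [convexHull_pair, segment_eq_Icc (by linarith)]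
  exact abs_le.1 ((hz i).trans ha)

end Symmetry

/-! ### The good level set in each of the three classes. -/

section Cases

variable {n : ℕ} {f : EuclideanSpace ℝ (Fin n) → ℝ} {μ : Measure (EuclideanSpace ℝ (Fin n))}

theorem IsUniformOnConvex.exists_ball_subset_levelSet (hu : IsUniformOnConvex μ)
    (hμ : IsIsotropicMeasure μ) (hlc : IsLogConcaveMeasure μ) (hf : IsLogConcaveDensity f μ) :
    ∃ t : ℝ, 0 < t ∧ volume (levelSet f t) ≤ ENNReal.ofReal 2 / eLpNorm f ∞ volume ∧
      Metric.ball 0 (1 / 960) ⊆ levelSet f t := by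
  have := hμ.isProbabilityMeasure
  obtain ⟨K, hK, hK0, hKt, rfl⟩ := hu
  -- `K` itself need not be Borel; its interior is, and differs from it by a null set.
  have hKU : interior K =ᵐ[volume] K := interior_ae_eq_of_null_frontier (hK.addHaar_frontier volume)
  have hc0 : (volume K)⁻¹ ≠ 0 := ENNReal.inv_ne_zero.2 hKt
  have hct : (volume K)⁻¹ ≠ ∞ := ENNReal.inv_ne_top.2 hK0
  set c := ((volume K)⁻¹).toReal with hc
  have hcpos : 0 < c := ENNReal.toReal_pos hc0 hct
  have hwd : (volume K)⁻¹ • volume.restrict K =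
      volume.withDensity ((interior K).indicator fun _ => (volume K)⁻¹) := by
    rw [withDensity_indicator isOpen_interior.measurableSet, withDensity_const,
      Measure.restrict_congr_set hKU]
  have hae : ∀ᵐ x, f x = (interior K).indicator (fun _ => c) x := by
    have h := (withDensity_eq_iff hf.aemeasurable.ennreal_ofReal
      (measurable_const.indicator isOpen_interior.measurableSet).aemeasurable
      (by rw [hf.lintegral_eq_one]; simp)).1 (hf.eq_withDensity.symm.trans hwd)
    filter_upwards [h] with x hx
    rw [← ENNReal.toReal_ofReal (hf.nonneg x), hx]
    by_cases hxK : x ∈ interior K <;> simp [hxK, hc]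
  have hnorm : eLpNorm f ∞ volume ≤ ENNReal.ofReal c := by
    rw [eLpNorm_exponent_top]
    refine eLpNormEssSup_le_of_ae_bound ?_
    filter_upwards [hae] with x hx
    rw [Real.norm_of_nonneg (hf.nonneg x), hx]
    exact Set.indicator_le_self' (fun _ _ => hcpos.le) x
  refine ⟨c, hcpos, ?_, ?_⟩
  · have h1 := hf.ofReal_mul_volume_levelSet_le c
    rw [mul_comm, ← ENNReal.le_div_iff_mul_le
      (Or.inl (by simpa using hcpos)) (Or.inl ENNReal.ofReal_ne_top)] at h1
    refine h1.trans (ENNReal.div_le_div ?_ hnorm)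
    rw [ENNReal.one_le_ofReal]
    norm_num
  · refine (hμ.ball_subset_interior hlc hf.absolutelyContinuous (hf.convex_levelSet hcpos)
      ?_).trans interior_subset
    have h0 : ((volume K)⁻¹ • volume.restrict K) (levelSet f c)ᶜ = 0 := by
      rw [Measure.smul_apply, ← Measure.restrict_congr_set hKU,
        Measure.restrict_apply' isOpen_interior.measurableSet]
      have h0 : volume ((levelSet f c)ᶜ ∩ interior K) = 0 := by
        refine measure_mono_null ?_ hae
        rintro x ⟨h1, h2⟩ h3
        simp only [Set.mem_ofPred_eq] at h3
        rw [Set.indicator_of_mem h2] at h3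
        exact h1 h3.ge
      rw [h0, smul_zero]
    rw [h0]
    exact zero_le

theorem volume_singleton_add_smul {r : ℝ} (hr : 0 < r) (y : EuclideanSpace ℝ (Fin n))
    (K : Set (EuclideanSpace ℝ (Fin n))) :
    volume ({y} + r • K) = ENNReal.ofReal r ^ n * volume K := by
  rw [Set.singleton_add, Set.image_add_left, measure_preimage_add, Measure.addHaar_smul,
    finrank_euclideanSpace_fin, abs_of_nonneg (by positivity), ENNReal.ofReal_pow hr.le]

/-- Volume comparison gives `r₁ ≤ B r₀`, so the ball inside `K_{t₁}`, transported by the similarity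
to `K_{t₀}`, keeps radius at least `1/(960B)`. -/
theorem HasHomogeneousLevelSets.exists_ball_subset_levelSet (hn : 1 ≤ n)
    (hh : HasHomogeneousLevelSets μ) (hμ : IsIsotropicMeasure μ) (hlc : IsLogConcaveMeasure μ)
    (hf : IsLogConcaveDensity f μ) :
    ∃ t : ℝ, 0 < t ∧ volume (levelSet f t) ≤ ENNReal.ofReal 2 / eLpNorm f ∞ volume ∧
      ∃ y, Metric.ball y (1 / 960 / (16 / (1 / 1000000) ^ 2)) ⊆ levelSet f t := by
  have := hμ.isProbabilityMeasure
  obtain ⟨g, hg, K, hK⟩ := hh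
  have hfg := hf.ae_eq hg
  have hnorm : eLpNorm f ∞ volume = eLpNorm g ∞ volume := eLpNorm_congr_ae hfg
  obtain ⟨t₀, t₁, ht₁, ht, hlt, hμt, hvol, hBvol⟩ :=
    hg.exists_levels hn (δ := 1 / 1000000) (by norm_num) (by norm_num)
  set B : ℝ := 16 / (1 / 1000000) ^ 2 with hB
  have hB0 : 0 < B := by positivity
  have ht₀ : 0 < t₀ := ht₁.trans_le ht
  have hball := (hμ.ball_subset_interior hlc hg.absolutelyContinuous (hg.convex_levelSet ht₁)
    hμt).trans interior_subset
  obtain ⟨r₀, hr₀, y₀, h0⟩ := hK t₀ ht₀ hlt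
  obtain ⟨r₁, hr₁, y₁, h1⟩ := hK t₁ ht₁ ((ENNReal.ofReal_le_ofReal ht).trans_lt hlt)
  have hv1 : volume (levelSet g t₁) ≠ 0 := fun h => by
    have := measure_mono_null hball h
    exact (Metric.measure_ball_pos volume _ (by norm_num)).ne' this
  have hv2 := hg.volume_levelSet_ne_top ht₁
  rw [h1, volume_singleton_add_smul hr₁] at hv1 hv2
  have hK0 : volume K ≠ 0 := right_ne_zero_of_mul hv1
  have hKt : volume K ≠ ∞ := fun h => by
    rw [h, ENNReal.mul_top (by simpa using fun h => absurd h hr₁.not_ge)] at hv2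
    exact hv2 rfl
  have hr : r₁ ≤ B * r₀ := by
    rw [h0, h1, volume_singleton_add_smul hr₁, volume_singleton_add_smul hr₀, ← mul_assoc,
      ENNReal.mul_le_mul_iff_left hK0 hKt, ← ENNReal.ofReal_pow hr₁.le, ← ENNReal.ofReal_pow hr₀.le,
      ← ENNReal.ofReal_mul (by positivity), ENNReal.ofReal_le_ofReal_iff (by positivity),
      ← mul_pow] at hBvol
    exact le_of_pow_le_pow_left₀ (by omega) (by positivity) hBvol
  refine ⟨t₀, ht₀, ?_, y₀ - (r₀ / r₁) • y₁, ?_⟩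
  · rw [hnorm]
    refine le_trans (measure_mono_ae ?_) hvol
    filter_upwards [hfg] with x hx h
    exact le_of_le_of_eq h hx
  · have hsub : Metric.ball (y₀ - (r₀ / r₁) • y₁) (1 / 960 / B) ⊆ levelSet g t₀ := by
      intro z hz
      rw [mem_ball_iff_norm] at hz
      have hz' : y₁ + (r₁ / r₀) • (z - y₀) ∈ levelSet g t₁ := by
        refine hball ?_
        rw [mem_ball_zero_iff]
        have e : y₁ + (r₁ / r₀) • (z - y₀) = (r₁ / r₀) • (z - (y₀ - (r₀ / r₁) • y₁)) := by
          have : (r₁ / r₀) * (r₀ / r₁) = 1 := by field_simp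
          rw [smul_sub, smul_sub, smul_sub, smul_smul, this, one_smul]
          abel
        rw [e, norm_smul, Real.norm_of_nonneg (by positivity)]
        calc r₁ / r₀ * ‖z - (y₀ - (r₀ / r₁) • y₁)‖ < r₁ / r₀ * (1 / 960 / B) := by gcongr
          _ ≤ B * (1 / 960 / B) := by
            gcongr
            rwa [div_le_iff₀ hr₀]
          _ = 1 / 960 := by field_simp
      rw [h1, Set.singleton_add] at hz'
      obtain ⟨_, ⟨k, hk, rfl⟩, hk'⟩ := hz'
      rw [h0, Set.singleton_add]
      refine ⟨r₀ • k, ⟨k, hk, rfl⟩, ?_⟩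
      have h3 : r₁ • k = (r₁ / r₀) • (z - y₀) := add_left_cancel hk'
      have h4 : r₀ • k = z - y₀ := by
        have := congrArg (fun v => (r₀ / r₁) • v) h3
        simp only [smul_smul] at this
        have e1 : r₀ / r₁ * r₁ = r₀ := by field_simp
        have e2 : r₀ / r₁ * (r₁ / r₀) = 1 := by field_simp
        rwa [e1, e2, one_smul] at this
      simp only
      rw [h4]
      abel
    -- Homogeneity is known only for `g`; the open ball passes to the arbitrary density `f` through
    -- interiors.
    have hint := (hf.convex_levelSet ht₀).interior_subset_interior_of_volume_diff
      (A := levelSet g t₀) (measure_mono_null (fun y hy => ?_) hfg)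
    · exact ((interior_maximal hsub Metric.isOpen_ball).trans hint).trans interior_subset
    · rintro h
      simp only [Set.mem_ofPred_eq] at h
      exact hy.2 (le_of_le_of_eq hy.1 h.symm)

/-- `K_{t₁}` contains a cube of side `2/960`, so `K_{t₀}` has volume at least `(2/(960B))^n`. It
cannot fit in a small cross-polytope, and a point outside that cross-polytope generates a cube by
symmetry. -/
theorem IsOneSymmetric.exists_closedBall_subset_levelSet (hn : 1 ≤ n)
    (hs : IsOneSymmetric μ) (hμ : IsIsotropicMeasure μ) (hlc : IsLogConcaveMeasure μ)
    (hf : IsLogConcaveDensity f μ) :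
    ∃ t : ℝ, 0 < t ∧ volume (levelSet f t) ≤ ENNReal.ofReal 2 / eLpNorm f ∞ volume ∧
      Metric.closedBall 0 (1 / 960 / (16 / (1 / 1000000) ^ 2) / 3) ⊆ levelSet f t := by
  have := hμ.isProbabilityMeasure
  obtain ⟨t₀, t₁, ht₁, ht, -, hμt, hvol, hBvol⟩ :=
    hf.exists_levels hn (δ := 1 / 1000000) (by norm_num) (by norm_num)
  set B : ℝ := 16 / (1 / 1000000) ^ 2 with hB
  have hB0 : 0 < B := by positivity
  have ht₀ : 0 < t₀ := ht₁.trans_le ht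
  have hcvx {t : ℝ} (h : 0 < t) : Convex ℝ (interior (levelSet f t)) :=
    (hf.convex_levelSet h).interior
  have hnull {t : ℝ} (h : 0 < t) : interior (levelSet f t) =ᵐ[volume] levelSet f t :=
    interior_ae_eq_of_null_frontier ((hf.convex_levelSet h).addHaar_frontier volume)
  have h1 : ENNReal.ofReal ((2 * (1 / 960)) ^ n) ≤ volume (levelSet f t₁) := by
    have hlt := hμ.lt_measure_lt_sum_abs hn hlc
    obtain ⟨x, hx, hxs⟩ : ∃ x ∈ interior (levelSet f t₁), 1 / 960 < (∑ i, |x i|) / n := by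
      by_contra! hcon
      refine absurd hlt (not_lt.2 (le_trans (measure_mono (t := (interior (levelSet f t₁))ᶜ)
        fun x hx hxi => ?_) ?_))
      · exact absurd (hcon x hxi) (not_le.2 hx)
      · rwa [measure_congr (hf.absolutelyContinuous.ae_le (hnull ht₁).compl)]
    have hsub := (hcvx ht₁).euclideanCube_subset_of_signedPerm hn
      (fun σ s x hx => hs.signedPerm_mem_interior_levelSet hf ht₁ σ s hx) hx hxs.le
    have := measure_mono (μ := volume) (hsub.trans interior_subset)
    rwa [volume_euclideanCube, ← ENNReal.ofReal_pow (by norm_num)] at this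
  refine ⟨t₀, ht₀, hvol, ?_⟩
  -- The `3` exceeds `e`, which makes `(2ea)^n` strictly less than the volume of `K_{t₀}`.
  set a : ℝ := 1 / 960 / B / 3 with ha
  have ha0 : 0 < a := by positivity
  obtain ⟨x, hx, hxs⟩ : ∃ x ∈ interior (levelSet f t₀), a < (∑ i, |x i|) / n := by
    by_contra! hcon
    have h2 := measure_mono (μ := volume) (s := interior (levelSet f t₀)) hcon
    have h3 := h2.trans (volume_sum_abs_div_le hn ha0.le)
    rw [measure_congr (hnull ht₀)] at h3
    have h4 : ENNReal.ofReal ((2 * (1 / 960)) ^ n) ≤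
        ENNReal.ofReal (B ^ n) * ENNReal.ofReal ((2 * Real.exp 1 * a) ^ n) :=
      h1.trans (hBvol.trans (by gcongr))
    rw [← ENNReal.ofReal_mul (by positivity), ENNReal.ofReal_le_ofReal_iff (by positivity),
      ← mul_pow] at h4
    have h5 := le_of_pow_le_pow_left₀ (by omega) (by positivity) h4
    have h6 : B * (2 * Real.exp 1 * a) = 2 * (1 / 960) * (Real.exp 1 / 3) := by
      rw [ha]; field_simp
    rw [h6] at h5
    have := Real.exp_one_lt_d9
    linarith
  exact ((closedBall_subset_euclideanCube n a).trans
    ((hcvx ht₀).euclideanCube_subset_of_signedPerm hn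
      (fun σ s x hx => hs.signedPerm_mem_interior_levelSet hf ht₀ σ s hx) hx hxs.le)).trans
    interior_subset

end Cases

/-- The level set at height `t` is the `log (c/t)`-dilate of the unit ball of the norm; the
restriction on `t` makes the factor positive. -/
theorem HasExpNormDensity.hasHomogeneousLevelSets {n : ℕ}
    {μ : Measure (EuclideanSpace ℝ (Fin n))} (h : HasExpNormDensity μ) :
    HasHomogeneousLevelSets μ := by
  obtain ⟨p, c, -, hc, hμ⟩ := h
  refine ⟨fun x => c * Real.exp (-p x), ⟨fun x => by positivity, fun x y l h0 h1 => ?_, hμ⟩,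
    {x | p x ≤ 1}, fun t ht hlt => ?_⟩
  · rw [Real.mul_rpow hc.le (Real.exp_nonneg _), Real.mul_rpow hc.le (Real.exp_nonneg _),
      ← Real.exp_mul, ← Real.exp_mul, mul_mul_mul_comm, ← Real.rpow_add hc, add_sub_cancel,
      Real.rpow_one, ← Real.exp_add]
    gcongr
    have h2 := map_add_le_add p (l • x) ((1 - l) • y)
    rw [map_smul_eq_mul, map_smul_eq_mul, Real.norm_of_nonneg h0,
      Real.norm_of_nonneg (sub_nonneg.2 h1)] at h2
    linarith
  · have htc : t < c := by
      have h1 : eLpNorm (fun x => c * Real.exp (-p x)) ∞ volume ≤ ENNReal.ofReal c := by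
        rw [eLpNorm_exponent_top]
        refine eLpNormEssSup_le_of_ae_bound ?_
        filter_upwards with x
        rw [Real.norm_of_nonneg (by positivity)]
        refine mul_le_of_le_one_right hc.le ?_
        rw [Real.exp_le_one_iff, neg_nonpos]
        exact apply_nonneg p x
      exact (ENNReal.ofReal_lt_ofReal_iff hc).1 (hlt.trans_le h1)
    have hr : 0 < Real.log (c / t) := Real.log_pos ((one_lt_div ht).2 htc)
    refine ⟨Real.log (c / t), hr, 0, ?_⟩
    ext x
    rw [Set.singleton_zero, zero_add, Set.mem_smul_set_iff_inv_smul_mem₀ hr.ne']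
    simp only [levelSet, Set.mem_ofPred_eq]
    rw [map_smul_eq_mul, norm_inv, Real.norm_of_nonneg hr.le, inv_mul_le_iff₀ hr, mul_one,
      Real.le_log_iff_exp_le (by positivity), le_div_iff₀ ht, Real.exp_neg, ← div_eq_mul_inv,
      le_div_iff₀ (Real.exp_pos _), mul_comm]

/-! ### The Prékopa–Leindler and Brunn–Minkowski inequalities. -/

section PrekopaLeindler

/-- The translates `A + inf B` and `sup A + B` lie in `A + B` and meet in at most one point. -/
theorem Real.volume_add_volume_le_of_isCompact {A B : Set ℝ} (hA : IsCompact A) (hB : IsCompact B)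
    (hA' : A.Nonempty) (hB' : B.Nonempty) : volume A + volume B ≤ volume (A + B) := by
  have hs := hA.sSup_mem hA'
  have hi := hB.sInf_mem hB'
  have hsub : (fun x => x + sInf B) '' A ∪ (fun x => sSup A + x) '' B ⊆ A + B := by
    rintro _ (⟨x, hx, rfl⟩ | ⟨x, hx, rfl⟩)
    · exact Set.add_mem_add hx hi
    · exact Set.add_mem_add hs hx
  have hd : AEDisjoint volume ((fun x => x + sInf B) '' A) ((fun x => sSup A + x) '' B) := by
    refine measure_mono_null ?_ (measure_singleton (sSup A + sInf B))
    rintro _ ⟨⟨x, hx, rfl⟩, ⟨y, hy, hxy⟩⟩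
    have h1 := le_csSup hA.bddAbove hx
    have h2 := csInf_le hB.bddBelow hy
    simp only at hxy
    rw [Set.mem_singleton_iff]
    simp only
    linarith
  have hm : MeasurableSet ((fun x => sSup A + x) '' B) :=
    (hB.image (by fun_prop)).measurableSet
  refine le_trans (le_of_eq ?_) (measure_mono hsub)
  rw [measure_union₀ hm.nullMeasurableSet hd]
  congr 1
  · rw [Set.image_add_right, measure_preimage_add_right]
  · rw [Set.image_add_left, measure_preimage_add]

theorem Real.volume_convex_combo_le {A B C : Set ℝ} (hA : MeasurableSet A) (hB : MeasurableSet B)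
    (hA' : A.Nonempty) (hB' : B.Nonempty) {l : ℝ} (h0 : 0 < l) (h1 : l < 1)
    (hC : ∀ x ∈ A, ∀ y ∈ B, l * x + (1 - l) * y ∈ C) :
    ENNReal.ofReal l * volume A + ENNReal.ofReal (1 - l) * volume B ≤ volume C := by
  obtain ⟨a, ha⟩ := hA'
  obtain ⟨b, hb⟩ := hB'
  rw [hA.measure_eq_iSup_isCompact, hB.measure_eq_iSup_isCompact]
  simp only [ENNReal.mul_iSup, iSup_and']
  refine ENNReal.biSup_add_biSup_le' ⟨∅, Set.empty_subset _, isCompact_empty⟩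
    ⟨∅, Set.empty_subset _, isCompact_empty⟩ fun K hK L hL => ?_
  -- The compact approximations may be empty, so a point of each set is added.
  have hK' : IsCompact (l • insert a K) := (hK.2.insert a).smul l
  have hL' : IsCompact ((1 - l) • insert b L) := (hL.2.insert b).smul (1 - l)
  have h := Real.volume_add_volume_le_of_isCompact hK' hL' (Set.insert_nonempty _ _).smul_set
    (Set.insert_nonempty _ _).smul_set
  rw [Measure.addHaar_smul, Measure.addHaar_smul, Module.finrank_self, pow_one, pow_one,
    abs_of_pos h0, abs_of_pos (sub_pos.2 h1)] at h
  calc ENNReal.ofReal l * volume K + ENNReal.ofReal (1 - l) * volume L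
      ≤ ENNReal.ofReal l * volume (insert a K) + ENNReal.ofReal (1 - l) * volume (insert b L) := by
        gcongr <;> exact Set.subset_insert _ _
    _ ≤ _ := h
    _ ≤ volume C := by
      refine measure_mono ?_
      rintro _ ⟨_, ⟨x, hx, rfl⟩, _, ⟨y, hy, rfl⟩, rfl⟩
      refine hC x ?_ y ?_
      · rcases hx with rfl | hx
        exacts [ha, hK.1 hx]
      · rcases hy with rfl | hy
        exacts [hb, hL.1 hy]

/-- With both suprema equal to one, the superlevel sets of `f` and `g` are nonempty for exactly the
same positive heights. The one-dimensional inequality can then be integrated over heights. -/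
theorem Real.prekopaLeindler_normalized {f g h : ℝ → ℝ} (hf : Measurable f) (hg : Measurable g)
    (hh : Measurable h) (hf0 : ∀ x, 0 ≤ f x) (hg0 : ∀ x, 0 ≤ g x) (hh0 : ∀ x, 0 ≤ h x)
    (hf1 : ∀ x, f x ≤ 1) (hg1 : ∀ x, g x ≤ 1) (hf' : ∀ t < 1, ∃ x, t < f x)
    (hg' : ∀ t < 1, ∃ x, t < g x) {l : ℝ} (h0 : 0 < l) (h1 : l < 1)
    (hfg : ∀ x y, f x ^ l * g y ^ (1 - l) ≤ h (l * x + (1 - l) * y)) :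
    ENNReal.ofReal l * (∫⁻ x, ENNReal.ofReal (f x)) + ENNReal.ofReal (1 - l) *
      (∫⁻ x, ENNReal.ofReal (g x)) ≤ ∫⁻ x, ENNReal.ofReal (h x) := by
  rw [lintegral_eq_lintegral_meas_lt volume (.of_forall hf0) hf.aemeasurable,
    lintegral_eq_lintegral_meas_lt volume (.of_forall hg0) hg.aemeasurable,
    lintegral_eq_lintegral_meas_lt volume (.of_forall hh0) hh.aemeasurable,
    ← lintegral_const_mul' _ _ ENNReal.ofReal_ne_top,
    ← lintegral_const_mul' _ _ ENNReal.ofReal_ne_top]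
  have hanti : Antitone fun t => volume {x | t < f x} := fun s t hst =>
    measure_mono fun x hx => lt_of_le_of_lt hst hx
  rw [← lintegral_add_left (hanti.measurable.const_mul _)]
  refine setLIntegral_mono' measurableSet_Ioi fun t ht => ?_
  have ht : 0 < t := ht
  rcases lt_or_ge t 1 with ht1 | ht1
  · refine Real.volume_convex_combo_le (measurableSet_lt measurable_const hf)
      (measurableSet_lt measurable_const hg) (hf' t ht1) (hg' t ht1) h0 h1 fun x hx y hy => ?_
    simp only [Set.mem_ofPred_eq] at hx hy ⊢
    refine lt_of_lt_of_le ?_ (hfg x y)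
    calc t = t ^ l * t ^ (1 - l) := by rw [← Real.rpow_add ht]; simp
      _ < f x ^ l * g y ^ (1 - l) :=
        mul_lt_mul'' (Real.rpow_lt_rpow ht.le hx h0) (Real.rpow_lt_rpow ht.le hy (sub_pos.2 h1))
          (by positivity) (by positivity)
  · have e1 : {x | t < f x} = ∅ :=
      Set.eq_empty_of_forall_notMem fun x hx => absurd (hf1 x) (not_le.2 (ht1.trans_lt hx))
    have e2 : {x | t < g x} = ∅ :=
      Set.eq_empty_of_forall_notMem fun x hx => absurd (hg1 x) (not_le.2 (ht1.trans_lt hx))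
    simp [e1, e2]

theorem ENNReal.rpow_mul_rpow_le_add (a b : ℝ≥0∞) {l : ℝ} (h0 : 0 < l) (h1 : l < 1) :
    a ^ l * b ^ (1 - l) ≤ ENNReal.ofReal l * a + ENNReal.ofReal (1 - l) * b := by
  have h1' := sub_pos.2 h1
  rcases eq_or_ne a ∞ with rfl | ha
  · rw [ENNReal.mul_top (by simpa using h0), top_add]; exact le_top
  rcases eq_or_ne b ∞ with rfl | hb
  · rw [ENNReal.mul_top (by simpa using h1), add_top]; exact le_top
  lift a to NNReal using ha
  lift b to NNReal using hb
  have := Real.geom_mean_le_arith_mean2_weighted h0.le h1'.le a.coe_nonneg b.coe_nonneg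
    (add_sub_cancel l 1)
  have h2 := ENNReal.ofReal_le_ofReal this
  rwa [ENNReal.ofReal_mul (by positivity), ENNReal.ofReal_add (by positivity) (by positivity),
    ENNReal.ofReal_mul h0.le, ENNReal.ofReal_mul h1'.le,
    ← ENNReal.ofReal_rpow_of_nonneg a.coe_nonneg h0.le,
    ← ENNReal.ofReal_rpow_of_nonneg b.coe_nonneg h1'.le,
    ENNReal.ofReal_coe_nnreal, ENNReal.ofReal_coe_nnreal] at h2

theorem Real.prekopaLeindler_bounded {f g h : ℝ → ℝ≥0∞} (hf : Measurable f) (hg : Measurable g)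
    (hh : Measurable h) (hF : ⨆ x, f x ≠ ∞) (hG : ⨆ x, g x ≠ ∞) {l : ℝ} (h0 : 0 < l) (h1 : l < 1)
    (hfg : ∀ x y, f x ^ l * g y ^ (1 - l) ≤ h (l * x + (1 - l) * y)) :
    (∫⁻ x, f x) ^ l * (∫⁻ x, g x) ^ (1 - l) ≤ ∫⁻ x, h x := by
  have h1' := sub_pos.2 h1
  set F := ⨆ x, f x with hFdef
  set G := ⨆ x, g x with hGdef
  rcases eq_or_ne F 0 with hF0 | hF0
  · have : ∀ x, f x = 0 := fun x => nonpos_iff_eq_zero.1 ((le_iSup f x).trans hF0.le)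
    simp [this, h0]
  rcases eq_or_ne G 0 with hG0 | hG0
  · have : ∀ x, g x = 0 := fun x => nonpos_iff_eq_zero.1 ((le_iSup g x).trans hG0.le)
    simp [this, h1]
  set P := F ^ l * G ^ (1 - l) with hP
  have hP0 : P ≠ 0 := mul_ne_zero (by simp [ENNReal.rpow_eq_zero_iff, hF0, hF])
    (by simp [ENNReal.rpow_eq_zero_iff, hG0, hG])
  have hPt : P ≠ ∞ := ENNReal.mul_ne_top (ENNReal.rpow_ne_top_of_nonneg h0.le hF)
    (ENNReal.rpow_ne_top_of_nonneg h1'.le hG)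
  have hfF : ∀ x, f x / F ≤ 1 := fun x => ENNReal.div_le_of_le_mul (by simpa using le_iSup f x)
  have hgG : ∀ x, g x / G ≤ 1 := fun x => ENNReal.div_le_of_le_mul (by simpa using le_iSup g x)
  have hsup : ∀ {k : ℝ → ℝ≥0∞}, ⨆ x, k x ≠ ∞ → ⨆ x, k x ≠ 0 → (∀ x, k x / ⨆ x, k x ≤ 1) →
      ∀ t < (1 : ℝ), ∃ x, t < (k x / ⨆ x, k x).toReal := by
    intro k hk hk0 hk1 t ht
    rcases lt_or_ge t 0 with ht0 | ht0
    · exact ⟨0, ht0.trans_le ENNReal.toReal_nonneg⟩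
    have hlt : ENNReal.ofReal t * ⨆ x, k x < ⨆ x, k x := by
      conv_rhs => rw [← one_mul (⨆ x, k x)]
      exact ENNReal.mul_lt_mul_left hk0 hk (by simpa using ht)
    obtain ⟨x, hx⟩ := lt_iSup_iff.1 hlt
    refine ⟨x, ?_⟩
    rw [← ENNReal.ofReal_lt_iff_lt_toReal ht0 (ne_top_of_le_ne_top ENNReal.one_ne_top (hk1 x))]
    rwa [ENNReal.lt_div_iff_mul_lt (Or.inl hk0) (Or.inl hk)]
  -- Capping `h / P` at one keeps infinite values from becoming zero under `toReal`; the cap is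
  -- harmless because the left side is at most one.
  have hmain := Real.prekopaLeindler_normalized (f := fun x => (f x / F).toReal)
    (g := fun x => (g x / G).toReal) (h := fun x => (min (h x / P) 1).toReal)
    (hf.div_const _).ennreal_toReal (hg.div_const _).ennreal_toReal
    ((hh.div_const _).min measurable_const).ennreal_toReal
    (fun _ => ENNReal.toReal_nonneg) (fun _ => ENNReal.toReal_nonneg)
    (fun _ => ENNReal.toReal_nonneg)
    (fun x => ENNReal.toReal_le_of_le_ofReal zero_le_one (by simpa using hfF x))
    (fun x => ENNReal.toReal_le_of_le_ofReal zero_le_one (by simpa using hgG x))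
    (hsup hF hF0 hfF) (hsup hG hG0 hgG) h0 h1 (fun x y => ?_)
  · have ef : ∀ x, ENNReal.ofReal (f x / F).toReal = f x / F := fun x =>
      ENNReal.ofReal_toReal (ne_top_of_le_ne_top ENNReal.one_ne_top (hfF x))
    have eg : ∀ x, ENNReal.ofReal (g x / G).toReal = g x / G := fun x =>
      ENNReal.ofReal_toReal (ne_top_of_le_ne_top ENNReal.one_ne_top (hgG x))
    have eh : ∀ x, ENNReal.ofReal (min (h x / P) 1).toReal ≤ h x / P := fun x =>
      ENNReal.ofReal_toReal_le.trans (min_le_left _ _)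
    simp_rw [ef, eg] at hmain
    have h2 := (ENNReal.rpow_mul_rpow_le_add _ _ h0 h1).trans (hmain.trans (lintegral_mono eh))
    simp_rw [div_eq_mul_inv] at h2
    rw [lintegral_mul_const _ hf, lintegral_mul_const _ hg, lintegral_mul_const _ hh,
      ENNReal.mul_rpow_of_nonneg _ _ h0.le, ENNReal.mul_rpow_of_nonneg _ _ h1'.le,
      mul_mul_mul_comm, ENNReal.inv_rpow, ENNReal.inv_rpow,
      ← ENNReal.mul_inv (Or.inr (ENNReal.rpow_ne_top_of_nonneg h1'.le hG))
        (Or.inl (ENNReal.rpow_ne_top_of_nonneg h0.le hF)), ← hP,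
      ENNReal.mul_le_mul_iff_left (ENNReal.inv_ne_zero.2 hPt) (ENNReal.inv_ne_top.2 hP0)] at h2
    exact h2
  · rw [ENNReal.toReal_rpow, ENNReal.toReal_rpow, ← ENNReal.toReal_mul]
    refine ENNReal.toReal_mono (ne_top_of_le_ne_top ENNReal.one_ne_top (min_le_right _ _)) ?_
    refine le_min ?_ ?_
    · rw [ENNReal.div_rpow_of_nonneg _ _ h0.le, ENNReal.div_rpow_of_nonneg _ _ h1'.le,
        div_eq_mul_inv, div_eq_mul_inv, mul_mul_mul_comm,
        ← ENNReal.mul_inv (Or.inr (ENNReal.rpow_ne_top_of_nonneg h1'.le hG))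
        (Or.inl (ENNReal.rpow_ne_top_of_nonneg h0.le hF)), ← hP, ← div_eq_mul_inv]
      gcongr
      exact hfg x y
    · exact mul_le_one' (ENNReal.rpow_le_one (hfF x) h0.le) (ENNReal.rpow_le_one (hgG y) h1'.le)

theorem Real.prekopaLeindler {f g h : ℝ → ℝ≥0∞} (hf : Measurable f) (hg : Measurable g)
    (hh : Measurable h) {l : ℝ} (h0 : 0 < l) (h1 : l < 1)
    (hfg : ∀ x y, f x ^ l * g y ^ (1 - l) ≤ h (l * x + (1 - l) * y)) :
    (∫⁻ x, f x) ^ l * (∫⁻ x, g x) ^ (1 - l) ≤ ∫⁻ x, h x := by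
  have h1' := sub_pos.2 h1
  have htrunc : ∀ {k : ℝ → ℝ≥0∞}, Measurable k → ∀ {p : ℝ}, 0 < p →
      (∫⁻ x, k x) ^ p = ⨆ N : ℕ, (∫⁻ x, min (k x) N) ^ p := by
    intro k hk p hp
    have e : ∀ x, k x = ⨆ N : ℕ, min (k x) N := fun x => by
      refine le_antisymm ?_ (iSup_le fun N => min_le_left _ _)
      rw [← inf_iSup_eq, ENNReal.iSup_natCast]
      simp
    conv_lhs => rw [lintegral_congr e]
    rw [lintegral_iSup (fun N => hk.min measurable_const)
      (fun N M hNM x => min_le_min_left _ (by exact_mod_cast hNM))]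
    exact (ENNReal.orderIsoRpow p hp).map_iSup _
  rw [htrunc hf h0, htrunc hg h1']
  simp only [ENNReal.iSup_mul, ENNReal.mul_iSup]
  refine iSup_le fun N => iSup_le fun M => ?_
  refine Real.prekopaLeindler_bounded (hf.min measurable_const) (hg.min measurable_const) hh
    ?_ ?_ h0 h1 fun x y => le_trans ?_ (hfg x y)
  · exact ne_top_of_le_ne_top (ENNReal.natCast_ne_top _) (iSup_le fun x => min_le_right _ _)
  · exact ne_top_of_le_ne_top (ENNReal.natCast_ne_top _) (iSup_le fun x => min_le_right _ _)
  · gcongr <;> exact min_le_left _ _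

/-- The Prékopa–Leindler inequality. -/
theorem MeasureTheory.prekopaLeindler {l : ℝ} (h0 : 0 < l) (h1 : l < 1) :
    ∀ (n : ℕ) {f g h : (Fin n → ℝ) → ℝ≥0∞}, Measurable f → Measurable g → Measurable h →
      (∀ x y, f x ^ l * g y ^ (1 - l) ≤ h (l • x + (1 - l) • y)) →
      (∫⁻ x, f x) ^ l * (∫⁻ x, g x) ^ (1 - l) ≤ ∫⁻ x, h x := by
  intro n
  induction n with
  | zero =>
    intro f g h hf hg hh hfg
    have hv : volume (Set.univ : Set (Fin 0 → ℝ)) = 1 := by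
      rw [← Set.pi_univ Set.univ, volume_pi_pi, Finset.univ_eq_empty, Finset.prod_empty]
    rw [lintegral_unique, lintegral_unique, lintegral_unique, hv, mul_one, mul_one, mul_one]
    exact (hfg _ _).trans_eq (congrArg h (Subsingleton.elim _ _))
  | succ n ih =>
    intro f g h hf hg hh hfg
    have hsplit : ∀ {k : (Fin (n + 1) → ℝ) → ℝ≥0∞}, Measurable k →
        ∫⁻ x, k x = ∫⁻ a : ℝ, ∫⁻ y : Fin n → ℝ, k (Fin.cons a y) := by
      intro k hk
      have hmp := (volume_preserving_piFinSuccAbove (fun _ : Fin (n + 1) => ℝ) 0).symm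
      rw [← hmp.lintegral_comp hk]
      change ∫⁻ z, k _ ∂((volume : Measure ℝ).prod volume) = _
      rw [lintegral_prod (fun z => k _) (hk.comp (MeasurableEquiv.measurable _)).aemeasurable]
      simp [MeasurableEquiv.piFinSuccAbove, Fin.insertNthEquiv, Fin.insertNth_zero']
    have hcons : Measurable fun z : ℝ × (Fin n → ℝ) => (Fin.cons z.1 z.2 : Fin (n + 1) → ℝ) := by
      refine measurable_pi_iff.2 fun i => ?_
      refine Fin.cases ?_ (fun j => ?_) i
      · simpa using measurable_fst
      · simpa [Function.comp_def] using (measurable_pi_apply j).comp (measurable_snd (α := ℝ) (β := Fin n → ℝ))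
    rw [hsplit hf, hsplit hg, hsplit hh]
    -- The fibre integrals satisfy the one-dimensional hypothesis by induction.
    refine Real.prekopaLeindler (hf.comp hcons).lintegral_prod_right'
      (hg.comp hcons).lintegral_prod_right' (hh.comp hcons).lintegral_prod_right' h0 h1
      fun a b => ?_
    refine ih (hf.comp (hcons.comp measurable_prodMk_left))
      (hg.comp (hcons.comp measurable_prodMk_left)) (hh.comp (hcons.comp measurable_prodMk_left))
      fun x y => ?_
    refine (hfg (Fin.cons a x) (Fin.cons b y)).trans (le_of_eq ?_)
    simp only [Function.comp]
    congr 1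
    ext i
    refine Fin.cases ?_ (fun j => ?_) i <;> simp

/-- The multiplicative Brunn–Minkowski inequality. -/
theorem EuclideanSpace.volume_rpow_mul_volume_rpow_le {n : ℕ}
    {A B C : Set (EuclideanSpace ℝ (Fin n))} (hA : MeasurableSet A) (hB : MeasurableSet B)
    (hC : MeasurableSet C) {l : ℝ} (h0 : 0 < l) (h1 : l < 1) (hABC : l • A + (1 - l) • B ⊆ C) :
    volume A ^ l * volume B ^ (1 - l) ≤ volume C := by
  have hm : Measurable (WithLp.toLp 2 : (Fin n → ℝ) → EuclideanSpace ℝ (Fin n)) :=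
    (PiLp.volume_preserving_toLp (Fin n)).measurable
  have hvol : ∀ {S : Set (EuclideanSpace ℝ (Fin n))}, MeasurableSet S →
      volume S = ∫⁻ x : Fin n → ℝ, S.indicator 1 (WithLp.toLp 2 x) := by
    intro S hS
    rw [(PiLp.volume_preserving_toLp (Fin n)).lintegral_comp (measurable_one.indicator hS),
      lintegral_indicator_one hS]
  rw [hvol hA, hvol hB, hvol hC]
  refine prekopaLeindler h0 h1 n ((measurable_one.indicator hA).comp hm)
    ((measurable_one.indicator hB).comp hm) ((measurable_one.indicator hC).comp hm) fun x y => ?_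
  by_cases hx : (WithLp.toLp 2 x : EuclideanSpace ℝ (Fin n)) ∈ A
  · by_cases hy : (WithLp.toLp 2 y : EuclideanSpace ℝ (Fin n)) ∈ B
    · have : (WithLp.toLp 2 (l • x + (1 - l) • y) : EuclideanSpace ℝ (Fin n)) ∈ C :=
        hABC (Set.add_mem_add (Set.smul_mem_smul_set hx) (Set.smul_mem_smul_set hy))
      simp [hx, hy, -WithLp.toLp_add, -WithLp.toLp_smul, this]
    · simp [hy, sub_pos.2 h1]
  · simp [hx, h0]

end PrekopaLeindler

/-! ### The cube as extremal example. -/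

section Cube

variable {n : ℕ}

/-- The uniform probability measure on a set. -/
noncomputable def uniformMeasure (K : Set (EuclideanSpace ℝ (Fin n))) :
    Measure (EuclideanSpace ℝ (Fin n)) := (volume K)⁻¹ • volume.restrict K

theorem uniformMeasure_apply {K : Set (EuclideanSpace ℝ (Fin n))} (hKm : MeasurableSet K)
    (A : Set (EuclideanSpace ℝ (Fin n))) :
    uniformMeasure K A = (volume K)⁻¹ * volume (A ∩ K) := by
  rw [uniformMeasure, Measure.smul_apply, Measure.restrict_apply' hKm, smul_eq_mul]

theorem isProbabilityMeasure_uniformMeasure {K : Set (EuclideanSpace ℝ (Fin n))}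
    (hKm : MeasurableSet K) (hK0 : volume K ≠ 0) (hKt : volume K ≠ ∞) :
    IsProbabilityMeasure (uniformMeasure K) :=
  ⟨by rw [uniformMeasure_apply hKm, Set.univ_inter, ENNReal.inv_mul_cancel hK0 hKt]⟩

theorem isLogConcaveMeasure_uniformMeasure {K : Set (EuclideanSpace ℝ (Fin n))}
    (hK : Convex ℝ K) (hKm : MeasurableSet K) (hK0 : volume K ≠ 0) (hKt : volume K ≠ ∞) :
    IsLogConcaveMeasure (uniformMeasure K) := by
  intro A B hA hB l h0 h1
  have h1' := sub_pos.2 h1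
  rw [uniformMeasure_apply hKm, uniformMeasure_apply hKm, uniformMeasure_apply hKm,
    ENNReal.mul_rpow_of_nonneg _ _ h0.le, ENNReal.mul_rpow_of_nonneg _ _ h1'.le, mul_mul_mul_comm,
    ← ENNReal.rpow_add _ _ (ENNReal.inv_ne_zero.2 hKt) (ENNReal.inv_ne_top.2 hK0), add_sub_cancel,
    ENNReal.rpow_one]
  gcongr
  -- A sum of Borel sets need not be Borel, so Brunn–Minkowski is applied to compact subsets, whose
  -- sums are compact.
  have hsup : ∀ {S : Set (EuclideanSpace ℝ (Fin n))}, MeasurableSet S → ∀ {p : ℝ}, 0 < p →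
      volume S ^ p = ⨆ L : Set (EuclideanSpace ℝ (Fin n)), ⨆ _ : L ⊆ S, ⨆ _ : IsCompact L,
        volume L ^ p := by
    intro S hS p hp
    rw [hS.measure_eq_iSup_isCompact]
    change ENNReal.orderIsoRpow p hp _ = _
    simp only [OrderIso.map_iSup, ENNReal.orderIsoRpow_apply]
  rw [hsup (hA.inter hKm) h0, hsup (hB.inter hKm) h1']
  simp only [ENNReal.iSup_mul, ENNReal.mul_iSup]
  refine iSup_le fun M => iSup₂_le fun hMB hM => iSup_le fun L => iSup₂_le fun hLA hL => ?_
  have hc : IsCompact (l • L + (1 - l) • M) := (hL.smul l).add (hM.smul (1 - l))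
  refine (EuclideanSpace.volume_rpow_mul_volume_rpow_le hL.measurableSet hM.measurableSet
    hc.measurableSet h0 h1 subset_rfl).trans (measure_mono ?_)
  rintro _ ⟨_, ⟨x, hx, rfl⟩, _, ⟨y, hy, rfl⟩, rfl⟩
  exact ⟨Set.add_mem_add (Set.smul_mem_smul_set (hLA hx).1) (Set.smul_mem_smul_set (hMB hy).1),
    hK (hLA hx).2 (hMB hy).2 h0.le h1'.le (add_sub_cancel l 1)⟩

theorem hasHomogeneousLevelSets_uniformMeasure {K : Set (EuclideanSpace ℝ (Fin n))}
    (hK : Convex ℝ K) (hKm : MeasurableSet K) (hK0 : volume K ≠ 0) (hKt : volume K ≠ ∞) :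
    HasHomogeneousLevelSets (uniformMeasure K) := by
  set c := ((volume K)⁻¹).toReal with hc
  have hcpos : 0 < c := ENNReal.toReal_pos (ENNReal.inv_ne_zero.2 hKt) (ENNReal.inv_ne_top.2 hK0)
  have hnn : ∀ x, 0 ≤ K.indicator (fun _ => c) x := fun x =>
    Set.indicator_nonneg (fun _ _ => hcpos.le) x
  refine ⟨K.indicator fun _ => c, ⟨hnn, fun x y l h0 h1 => ?_, ?_⟩, K, fun t ht hlt => ?_⟩
  · rcases h0.eq_or_lt with rfl | h0
    · simp
    rcases h1.eq_or_lt with rfl | h1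
    · simp
    have h1' := sub_pos.2 h1
    by_cases hx : x ∈ K
    · by_cases hy : y ∈ K
      · have := hK hx hy h0.le h1'.le (add_sub_cancel l 1)
        rw [Set.indicator_of_mem hx, Set.indicator_of_mem hy, Set.indicator_of_mem this,
          ← Real.rpow_add hcpos, add_sub_cancel, Real.rpow_one]
      · rw [Set.indicator_of_notMem hy, Real.zero_rpow h1'.ne', mul_zero]
        exact hnn _
    · rw [Set.indicator_of_notMem hx, Real.zero_rpow h0.ne', zero_mul]
      exact hnn _
  · have : (fun x => ENNReal.ofReal (K.indicator (fun _ => c) x)) =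
        K.indicator fun _ => (volume K)⁻¹ := by
      ext x
      by_cases hx : x ∈ K
      · rw [Set.indicator_of_mem hx, Set.indicator_of_mem hx, hc,
          ENNReal.ofReal_toReal (ENNReal.inv_ne_top.2 hK0)]
      · simp [hx]
    rw [this, withDensity_indicator hKm, withDensity_const, uniformMeasure]
  · have htc : t < c := by
      have h1 : eLpNorm (K.indicator fun _ => c) ∞ volume ≤ ENNReal.ofReal c := by
        rw [eLpNorm_exponent_top]
        refine eLpNormEssSup_le_of_ae_bound ?_
        filter_upwards with x
        rw [Real.norm_of_nonneg (hnn x)]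
        exact Set.indicator_le_self' (fun _ _ => hcpos.le) x
      exact (ENNReal.ofReal_lt_ofReal_iff hcpos).1 (hlt.trans_le h1)
    refine ⟨1, one_pos, 0, ?_⟩
    rw [one_smul, Set.singleton_zero, zero_add]
    ext x
    by_cases hx : x ∈ K
    · simp [levelSet, hx, htc.le]
    · simp [levelSet, hx, ht]

theorem map_signedPerm_uniformMeasure_euclideanCube (a : ℝ) (σ : Equiv.Perm (Fin n))
    (s : Fin n → ℤˣ) :
    (uniformMeasure (euclideanCube n a)).map (signedPerm σ s) =
      uniformMeasure (euclideanCube n a) := by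
  have hpre : signedPerm σ s ⁻¹' euclideanCube n a = euclideanCube n a := by
    ext x
    have h : ∀ i, |((s i : ℤ) : ℝ) * x (σ i)| = |x (σ i)| := fun i => by
      rcases Int.units_eq_one_or (s i) with h | h <;> simp [h]
    simp only [coe_signedPerm, Set.mem_preimage, euclideanCube, Set.mem_ofPred_eq, h]
    exact σ.forall_congr_right (q := fun i => |x i| ≤ a)
  have h := ((signedPerm σ s).measurePreserving).restrict_preimage
    (measurableSet_euclideanCube n a)
  rw [hpre] at h
  rw [uniformMeasure, Measure.map_smul, h.map_eq]

theorem integral_apply_sq_uniformMeasure_euclideanCube (i : Fin n) :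
    ∫ x : EuclideanSpace ℝ (Fin n), x i ^ 2 ∂(uniformMeasure (euclideanCube n √3)) = 1 := by
  have h3 : (0 : ℝ) < √3 := by positivity
  have hmp : MeasurePreserving (MeasurableEquiv.toLp 2 (Fin n → ℝ)).symm
      (volume.restrict (euclideanCube n √3))
      (volume.restrict (Set.univ.pi fun _ : Fin n => Set.Icc (-√3) √3)) := by
    rw [euclideanCube_eq_preimage]
    exact (EuclideanSpace.volume_preserving_symm_measurableEquiv_toLp (Fin n)).restrict_preimage
      (MeasurableSet.univ_pi fun _ => measurableSet_Icc)
  have h1 : ∫ x in euclideanCube n √3, x i ^ 2 = (2 * √3) ^ n := by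
    have e := hmp.integral_comp (MeasurableEquiv.measurableEmbedding _) fun y => y i ^ 2
    have e' : ∫ x in euclideanCube n √3, x i ^ 2 = ∫ y in (Set.univ.pi fun _ : Fin n =>
      Set.Icc (-√3) √3), y i ^ 2 := e
    rw [e', volume_pi, Measure.restrict_pi_pi]
    have h2 : ∀ y : Fin n → ℝ, y i ^ 2 = ∏ j, (fun t : ℝ => if j = i then t ^ 2 else 1) (y j) := by
      intro y
      simp
    simp_rw [h2]
    rw [integral_fintype_prod_eq_prod (f := fun j (t : ℝ) => if j = i then t ^ 2 else 1)]
    have h4 : ∀ j : Fin n, ∫ t in Set.Icc (-√3) √3, (if j = i then t ^ 2 else 1) = 2 * √3 := by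
      intro j
      rw [integral_Icc_eq_integral_Ioc, ← intervalIntegral.integral_of_le (by linarith)]
      split_ifs
      · rw [integral_pow]
        have : √3 ^ 3 = 3 * √3 := by
          rw [pow_succ, Real.sq_sqrt (by norm_num)]
        norm_num
        rw [neg_pow, this]
        ring
      · simp
        ring
    simp [h4]
  rw [uniformMeasure, integral_smul_measure, h1, volume_euclideanCube,
    ← ENNReal.ofReal_pow (by positivity), ← ENNReal.ofReal_inv_of_pos (by positivity),
    ENNReal.toReal_ofReal (by positivity), smul_eq_mul, inv_mul_cancel₀ (by positivity)]

theorem volume_euclideanCube_ne_zero {a : ℝ} (ha : 0 < a) : volume (euclideanCube n a) ≠ 0 := by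
  rw [volume_euclideanCube]
  exact pow_ne_zero _ (by simpa using ha)

theorem volume_euclideanCube_ne_top (a : ℝ) : volume (euclideanCube n a) ≠ ∞ := by
  rw [volume_euclideanCube]
  exact ENNReal.pow_ne_top ENNReal.ofReal_ne_top

/-- Invariance under sign changes kills the barycentre and the mixed moments; the half-side `√3`
normalises the diagonal ones. -/
theorem isIsotropicMeasure_uniformMeasure_euclideanCube :
    IsIsotropicMeasure (uniformMeasure (euclideanCube n √3)) := by
  set μ := uniformMeasure (euclideanCube n √3) with hμ
  have hprob : IsProbabilityMeasure μ := isProbabilityMeasure_uniformMeasure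
    (measurableSet_euclideanCube n _) (volume_euclideanCube_ne_zero (by positivity))
    (volume_euclideanCube_ne_top _)
  have hsym {V : Type} [NormedAddCommGroup V] [NormedSpace ℝ V] (s : Fin n → ℤˣ)
      (g : EuclideanSpace ℝ (Fin n) → V) : ∫ x, g (signedPerm 1 s x) ∂μ = ∫ x, g x ∂μ :=
    MeasurePreserving.integral_comp ⟨(signedPerm 1 s).continuous.measurable,
      map_signedPerm_uniformMeasure_euclideanCube √3 1 s⟩
      (signedPerm 1 s).toHomeomorph.measurableEmbedding g
  have hsq (i : Fin n) : ∫ x, x i ^ 2 ∂μ = 1 := integral_apply_sq_uniformMeasure_euclideanCube i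
  have hsqi (i : Fin n) : Integrable (fun x : EuclideanSpace ℝ (Fin n) => x i ^ 2) μ := by
    by_contra h
    have := hsq i
    rw [integral_undef h] at this
    exact zero_ne_one this
  have hij (i j : Fin n) : Integrable (fun x : EuclideanSpace ℝ (Fin n) => x i * x j) μ := by
    refine ((hsqi i).add (hsqi j)).mono' (by fun_prop) ?_
    filter_upwards with x
    rw [Real.norm_eq_abs, abs_le, Pi.add_apply]
    constructor <;> nlinarith [sq_nonneg (x i + x j), sq_nonneg (x i - x j)]
  have hoff (i j : Fin n) (h : i ≠ j) : ∫ x, x i * x j ∂μ = 0 := by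
    have := hsym (fun k => if k = i then -1 else 1) fun x => x i * x j
    simp only [coe_signedPerm, Equiv.Perm.coe_one, id_eq, if_true, if_neg h.symm, Units.val_neg,
      Units.val_one, Int.cast_neg, Int.cast_one, neg_mul, one_mul, integral_neg] at this
    linarith
  refine ⟨hprob, ?_, fun θ hθ => ?_⟩
  · have hT : ∀ x, signedPerm (n := n) 1 (fun _ => -1) x = -x := fun x => by
      ext i
      simp [coe_signedPerm]
    have h1 := hsym (fun _ => -1) fun x => x
    simp_rw [hT] at h1
    rw [integral_neg, neg_eq_iff_add_eq_zero, ← two_smul ℝ] at h1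
    exact (smul_eq_zero.1 h1).resolve_left two_ne_zero
  · have h1 : ∀ x : EuclideanSpace ℝ (Fin n), (inner ℝ x θ) ^ 2 =
        ∑ i, ∑ j, (θ i * θ j) * (x i * x j) := fun x => by
      rw [PiLp.inner_apply, sq, Finset.sum_mul_sum]
      refine Finset.sum_congr rfl fun i _ => Finset.sum_congr rfl fun j _ => ?_
      simp
      ring
    simp_rw [h1]
    rw [integral_finsetSum _ fun i _ => integrable_finsetSum _ fun j _ => (hij i j).const_mul _]
    have h2 : ∀ i, ∫ x, ∑ j, (θ i * θ j) * (x i * x j) ∂μ = θ i ^ 2 := fun i => by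
      rw [integral_finsetSum _ fun j _ => (hij i j).const_mul _, Finset.sum_eq_single i]
      · rw [integral_const_mul]
        simp_rw [← sq]
        rw [hsq, mul_one]
      · intro j _ hj
        rw [integral_const_mul, hoff i j hj.symm, mul_zero]
      · simp
    simp_rw [h2]
    rw [← EuclideanSpace.real_norm_sq_eq, hθ, one_pow]

/-- The shell contains `n` disjoint slabs of thickness `ε`, one on each positive face. -/
theorem le_volume_euclideanCube_shell {b ε : ℝ} (hb : 0 ≤ b) (hε : 0 < ε) :
    ENNReal.ofReal (n * (ε * (2 * b) ^ (n - 1))) ≤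
      volume (((euclideanCube n b + ε • Metric.closedBall 0 1) \ euclideanCube n b) ∩
        euclideanCube n (b + ε)) := by
  set P : Fin n → Set (Fin n → ℝ) := fun i => Set.univ.pi
    (Function.update (fun _ => Set.Icc (-b) b) i (Set.Ioc b (b + ε))) with hP
  set F : Fin n → Set (EuclideanSpace ℝ (Fin n)) := fun i =>
    (MeasurableEquiv.toLp 2 (Fin n → ℝ)).symm ⁻¹' P i with hF
  have hmem : ∀ i x, x ∈ F i ↔ (b < x i ∧ x i ≤ b + ε) ∧ ∀ j, j ≠ i → |x j| ≤ b := by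
    intro i x
    simp only [hF, hP, Set.mem_preimage, Set.mem_univ_pi]
    constructor
    · intro h
      refine ⟨by simpa using h i, fun j hj => ?_⟩
      have := h j
      rw [Function.update_of_ne hj] at this
      exact abs_le.2 this
    · rintro ⟨h1, h2⟩ j
      by_cases hj : j = i
      · subst hj
        simpa using h1
      · rw [Function.update_of_ne hj]
        exact abs_le.1 (h2 j hj)
  have hPm : ∀ i, MeasurableSet (P i) := fun i => MeasurableSet.univ_pi fun j => by
    by_cases hj : j = i
    · subst hj
      simp
    · rw [Function.update_of_ne hj]
      exact measurableSet_Icc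
  have hFm : ∀ i, MeasurableSet (F i) := fun i => (MeasurableEquiv.measurable _) (hPm i)
  have hFv : ∀ i, volume (F i) = ENNReal.ofReal (ε * (2 * b) ^ (n - 1)) := fun i => by
    rw [hF, (EuclideanSpace.volume_preserving_symm_measurableEquiv_toLp (Fin n)).measure_preimage
      (hPm i).nullMeasurableSet, hP, volume_pi_pi, ← Finset.mul_prod_erase _ _ (Finset.mem_univ i),
      Function.update_self, Finset.prod_congr rfl (g := fun _ => ENNReal.ofReal (2 * b))]
    · rw [Real.volume_Ioc, Finset.prod_const, Finset.card_erase_of_mem (Finset.mem_univ i),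
        Finset.card_univ, Fintype.card_fin, ENNReal.ofReal_mul hε.le,
        ENNReal.ofReal_pow (by positivity), add_sub_cancel_left]
    · intro j hj
      rw [Function.update_of_ne (Finset.ne_of_mem_erase hj), Real.volume_Icc]
      congr 1
      ring
  have hd : Pairwise (Function.onFun Disjoint F) := by
    intro i j hij
    rw [Function.onFun, Set.disjoint_left]
    intro x hi hj
    have h1 := ((hmem i x).1 hi).1.1
    have h2 := ((hmem j x).1 hj).2 i hij
    linarith [le_abs_self (x i)]
  have hsub : (⋃ i, F i) ⊆ ((euclideanCube n b + ε • Metric.closedBall 0 1) \ euclideanCube n b) ∩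
      euclideanCube n (b + ε) := by
    refine Set.iUnion_subset fun i x hx => ?_
    obtain ⟨⟨h1, h2⟩, h3⟩ := (hmem i x).1 hx
    refine ⟨⟨⟨x - EuclideanSpace.single i (x i - b), fun j => ?_,
      EuclideanSpace.single i (x i - b), ?_, sub_add_cancel _ _⟩, fun h => ?_⟩, fun j => ?_⟩
    · by_cases hj : j = i
      · subst hj
        simp [abs_of_nonneg hb]
      · simpa [hj] using h3 j hj
    · rw [smul_unitClosedBall, Real.norm_of_nonneg hε.le, mem_closedBall_zero_iff,
        PiLp.norm_single, Real.norm_of_nonneg (by linarith)]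
      linarith
    · linarith [h i, le_abs_self (x i)]
    · by_cases hj : j = i
      · subst hj
        rw [abs_of_nonneg (by linarith)]
        exact h2
      · linarith [h3 j hj]
  refine le_trans (le_of_eq ?_) (measure_mono hsub)
  rw [measure_iUnion hd hFm, tsum_fintype]
  simp only [hFv, Finset.sum_const, Finset.card_univ, Fintype.card_fin, nsmul_eq_mul]
  rw [ENNReal.ofReal_mul (by positivity), ENNReal.ofReal_natCast]

theorem le_maxPerimeter_uniformMeasure_euclideanCube (hn : 1 ≤ n) :
    ENNReal.ofReal (1 / 12 * n) ≤ maxPerimeter (uniformMeasure (euclideanCube n √3)) := by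
  have hn0 : (0 : ℝ) < n := by exact_mod_cast hn
  have h3 : (0 : ℝ) < √3 := by positivity
  -- The smaller cube leaves room for its shell inside the support, while `(n/(n+1))^(n-1) ≥ 1/e ≥
  -- 1/3` costs only a constant. With `√3 ≤ 2` this gives `1/12`.
  set b : ℝ := √3 * (n / (n + 1)) with hb
  have hb0 : 0 < b := by positivity
  have hb3 : b < √3 := mul_lt_of_lt_one_right h3 ((div_lt_one (by positivity)).2 (by linarith))
  refine le_trans ?_ (le_iSup₂ (f := fun Q (_ : Convex ℝ Q) =>
    perimeter (uniformMeasure (euclideanCube n √3)) Q) (euclideanCube n b)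
    (convex_euclideanCube n b))
  refine le_liminf_of_le (by isBoundedDefault) ?_
  filter_upwards [Ioo_mem_nhdsGT (sub_pos.2 hb3)] with ε hε
  have hε0 : 0 < ε := hε.1
  have hsub : euclideanCube n (b + ε) ⊆ euclideanCube n √3 := fun x hx i =>
    (hx i).trans (by linarith [hε.2])
  have h1 := (le_volume_euclideanCube_shell (n := n) hb0.le hε0).trans
    (measure_mono (Set.inter_subset_inter_right _ hsub))
  rw [ENNReal.le_div_iff_mul_le (Or.inl (by simpa using hε0)) (Or.inl ENNReal.ofReal_ne_top),
    uniformMeasure_apply (measurableSet_euclideanCube n _)]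
  refine le_trans ?_ (mul_le_mul_right h1 _)
  rw [volume_euclideanCube, ← ENNReal.ofReal_pow (by positivity),
    ← ENNReal.ofReal_inv_of_pos (by positivity), ← ENNReal.ofReal_mul (by positivity),
    ← ENNReal.ofReal_mul (by positivity)]
  refine ENNReal.ofReal_le_ofReal ?_
  obtain ⟨m, rfl⟩ : ∃ m, n = m + 1 := ⟨n - 1, by omega⟩
  have hexp : ((m + 1 : ℕ) + 1 : ℝ) ^ m ≤ 3 * ((m + 1 : ℕ) : ℝ) ^ m := by
    have e1 : ((m + 1 : ℕ) + 1 : ℝ) = (1 + 1 / ((m + 1 : ℕ) : ℝ)) * ((m + 1 : ℕ) : ℝ) := by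
      field_simp
    rw [e1, mul_pow]
    gcongr
    have e2 : 1 + 1 / ((m + 1 : ℕ) : ℝ) ≤ Real.exp (1 / ((m + 1 : ℕ) : ℝ)) := by
      rw [add_comm]
      exact Real.add_one_le_exp _
    calc (1 + 1 / ((m + 1 : ℕ) : ℝ)) ^ m ≤ Real.exp (1 / ((m + 1 : ℕ) : ℝ)) ^ m := by gcongr
      _ = Real.exp (m * (1 / ((m + 1 : ℕ) : ℝ))) := (Real.exp_nat_mul _ _).symm
      _ ≤ Real.exp 1 := by
        gcongr
        rw [mul_one_div, div_le_one hn0]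
        push_cast
        linarith
      _ ≤ 3 := by linarith [Real.exp_one_lt_d9]
  rw [add_tsub_cancel_right, hb]
  have hs2 : √3 ≤ 2 := by
    rw [Real.sqrt_le_left (by norm_num)]
    norm_num
  have e3 : (2 * (√3 * (((m + 1 : ℕ) : ℝ) / ((m + 1 : ℕ) + 1)))) ^ m =
      (2 * √3) ^ m * (((m + 1 : ℕ) : ℝ) ^ m / (((m + 1 : ℕ) : ℝ) + 1) ^ m) := by
    rw [← div_pow, ← mul_pow, mul_assoc]
  have e4 : (1 / 3 : ℝ) ≤ ((m + 1 : ℕ) : ℝ) ^ m / (((m + 1 : ℕ) : ℝ) + 1) ^ m := by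
    rw [le_div_iff₀ (by positivity)]
    linarith
  rw [e3]
  calc 1 / 12 * ((m + 1 : ℕ) : ℝ) * ε
      = ((m + 1 : ℕ) : ℝ) * ε * (1 / (2 * 2)) * (1 / 3) := by ring
    _ ≤ ((m + 1 : ℕ) : ℝ) * ε * (1 / (2 * √3)) *
        (((m + 1 : ℕ) : ℝ) ^ m / (((m + 1 : ℕ) : ℝ) + 1) ^ m) := by gcongr
    _ = _ := by
      rw [pow_succ]
      field_simp

end Cube

/-! ### The main theorem. -/

theorem mainTheorem10 :
    (∃ C₁ C₂ C : ℝ, 0 < C₁ ∧ 0 < C₂ ∧ 0 < C ∧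
      ∀ n : ℕ, 1 ≤ n → ∀ μ : Measure (EuclideanSpace ℝ (Fin n)),
        IsLogConcaveMeasure μ → IsIsotropicMeasure μ →
        (IsUniformOnConvex μ ∨ HasHomogeneousLevelSets μ ∨ IsOneSymmetric μ) →
        (∃ f : EuclideanSpace ℝ (Fin n) → ℝ, IsLogConcaveDensity f μ) ∧
        (∀ f : EuclideanSpace ℝ (Fin n) → ℝ, IsLogConcaveDensity f μ →
          ∃ t : ℝ, 0 < t ∧
            volume (levelSet f t) ≤ ENNReal.ofReal C₁ / eLpNorm f ∞ volume ∧
            ∃ y : EuclideanSpace ℝ (Fin n), Metric.closedBall y C₂ ⊆ levelSet f t) ∧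
        maxPerimeter μ ≤ ENNReal.ofReal (C * n)) ∧
    (∀ n : ℕ, 1 ≤ n → ∀ μ : Measure (EuclideanSpace ℝ (Fin n)),
      HasExpNormDensity μ → HasHomogeneousLevelSets μ) ∧
    (∃ c : ℝ, 0 < c ∧ ∀ n : ℕ, 1 ≤ n → ∃ μ : Measure (EuclideanSpace ℝ (Fin n)),
      IsLogConcaveMeasure μ ∧ IsIsotropicMeasure μ ∧
      IsUniformOnConvex μ ∧ HasHomogeneousLevelSets μ ∧ IsOneSymmetric μ ∧
      ENNReal.ofReal (c * n) ≤ maxPerimeter μ) := by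

  refine ⟨?_, fun n _ μ h => h.hasHomogeneousLevelSets, 1 / 12, by norm_num, fun n hn => ?_⟩
  -- The radius from the 1-symmetric case, the smallest of the three. The open balls of the other
  -- two cases contain closed balls of this radius.
  · set ρ : ℝ := 1 / 960 / (16 / (1 / 1000000) ^ 2) / 3 with hρ
    have hρ0 : 0 < ρ := by positivity
    refine ⟨2, ρ, (1 + 2) / ρ, by norm_num, hρ0, by positivity, fun n hn μ hlc hμ hcases => ?_⟩
    have := hμ.isProbabilityMeasure
    have key : ∀ f : EuclideanSpace ℝ (Fin n) → ℝ, IsLogConcaveDensity f μ →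
        ∃ t : ℝ, 0 < t ∧ volume (levelSet f t) ≤ ENNReal.ofReal 2 / eLpNorm f ∞ volume ∧
          ∃ y : EuclideanSpace ℝ (Fin n), Metric.closedBall y ρ ⊆ levelSet f t := by
      intro f hf
      rcases hcases with h | h | h
      · obtain ⟨t, ht, hv, hb⟩ := h.exists_ball_subset_levelSet hμ hlc hf
        exact ⟨t, ht, hv, 0, (Metric.closedBall_subset_ball (by rw [hρ]; norm_num)).trans hb⟩
      · obtain ⟨t, ht, hv, y, hb⟩ := h.exists_ball_subset_levelSet hn hμ hlc hf
        exact ⟨t, ht, hv, y, (Metric.closedBall_subset_ball (by rw [hρ]; norm_num)).trans hb⟩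
      · obtain ⟨t, ht, hv, hb⟩ := h.exists_closedBall_subset_levelSet hn hμ hlc hf
        exact ⟨t, ht, hv, 0, hb⟩
    obtain ⟨f, hf⟩ := hμ.exists_isLogConcaveDensity hlc
    obtain ⟨t, ht, hv, y, hb⟩ := key f hf
    exact ⟨⟨f, hf⟩, key, hf.maxPerimeter_le zero_le_two ht hρ0 hv hb⟩
  · have hm := measurableSet_euclideanCube n √3
    have hc := convex_euclideanCube n √3
    have h0 : volume (euclideanCube n √3) ≠ 0 := volume_euclideanCube_ne_zero (by positivity)
    have ht : volume (euclideanCube n √3) ≠ ∞ := volume_euclideanCube_ne_top _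
    exact ⟨uniformMeasure (euclideanCube n √3), isLogConcaveMeasure_uniformMeasure hc hm h0 ht,
      isIsotropicMeasure_uniformMeasure_euclideanCube, ⟨_, hc, h0, ht, rfl⟩,
      hasHomogeneousLevelSets_uniformMeasure hc hm h0 ht,
      fun σ s => map_signedPerm_uniformMeasure_euclideanCube √3 σ s,
      le_maxPerimeter_uniformMeasure_euclideanCube hn⟩
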